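/- **Setting.** A network has $n$ nodes, at most $f$ of them Byzantine, the others correct. Time is divided into slots $s=1,2,\dots$ of $f+2$ rounds $\langle s,1\rangle,\dots,\langle s,f+2\rangle$; each round has a receive, a state update and a send phase. *Slot-sleepy model (GST $=0$):* in each slot every node is awake or asleep for the whole slot; a slot-$s$ asleep node has no phases in slot $s$ (in particular, every block with a slot-$s$ timestamp that reaches a correct node by round $\langle s+1,1\rangle$ was issued by a slot-$s$ awake node); whatever a correct node broadcasts in a round is received by every awake correct node in the next round, together with its past cone and with proofs of all equivocations known to the sender. Hashes are collision-free, signatures of correct nodes are unforgeable, and received blocks whose timestamp is not in the past are ignored; otherwise Byzantine nodes are arbitrary. **Blocks and digests.** A block $B$ carries hash references to earlier blocks, a digest, transactions, its timestamp and its (signed) creator; $\mathrm{Cone}(B)$ is the set of blocks reachable from $B$ (including $B$). $Genesis$ has no references, digest $0$ and time $\langle 0,f+2\rangle$. Digests are $\sigma_{-1}=0$ and $\sigma_s=\mathrm{Hash}(\sigma_{s-1},\mathrm{Concat}(X))$, where $X$ is the set of blocks of the local DAG created at or before slot $s$ and not committed by $\sigma_{s-1}$, and $\mathrm{Concat}$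 lists a finite set in some deterministic order; $\sigma_s$ commits the blocks in $X$ and those committed by $\sigma_{s-1}$; $\mathrm{Order}(\sigma_s)=\mathrm{Order}(\sigma_{s-1})\,\|\,\mathrm{Concat}(X)$, with $\mathrm{Order}(0)$ empty. $\mathrm{Chain}(\sigma_s)=(\sigma_{-1},\dots,\sigma_s)$; two digests conflict if neither is on the chain of the other. An equivocator in a set of blocks is a node with two blocks in it, neither reachable from the other. A cone is valid if all of it is known to the node, $Genesis$ is its only block without references and its only block of slot $0$, references go to strictly earlier times, a block of round $i<f+2$ in slot $s$ carries a digest for slot $s-2$ and one of round $f+2$ a digest for slot $s-1$ computed correctly from its own cone; a block of round $i\notin\{1,f+2\}$ references only blocks with its own digest, one of round $f+2$ only blocks with the predecessor of its digest, and one of round $1$ at least one block with its own digest, all other referenced blocks sharing one digest. A digest certificate (DC) for $\sigma$ is a block $A$ in the slot two after that of $\sigma$ whose cone contains blocks of at least $2f+1$ nodes, from the slot of $A$, with digest $\sigma$. A digest is final in a DAG that contains DCs for it by at least $2f+1$ nodes. **Protocol (Slipstream, the part determining $\mathrm{Order}_{\mathrm{own}}$).** Initially a node has DAG $\{Genesis\}$,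 digest $0$, $\mathrm{Order}_{\mathrm{own}}=(Genesis)$ and ELSS indicator $0$. In the state update of round $\langle s,i\rangle$ an awake correct node with current digest $\sigma$ does the following; at $\langle 1,1\rangle$ it only does step 3. 1. *UpdateDAG* (only if it created a block in the preceding round): going one by one through the known blocks $B$ of the preceding round that have digest $\sigma$, a completely known cone and a creator not known as an equivocator, it adds $\mathrm{Cone}(B)$ to its DAG if the cone is valid, no slot-$s$ block in it is by an equivocator found among the blocks committed by $\sigma$, and every block $C$ in it that is of a slot $<s$, not committed by $\sigma$ and not yet in the DAG is reachable from blocks in $\mathrm{Cone}(B)$, of the slot of $B$, by at least $i-1$ distinct nodes. 2. *If $i=1$ and it was asleep in slot $s-1$*, it adopts a most frequent digest among the last blocks of non-equivocating nodes that were created at $\langle s-1,f+2\rangle$, and merges the valid cones of non-equivocators' last blocks with this digest. *If $i=1$ and it was awake in slot $s-1$*, let $N_{\mathrm{total}}$ be the number of non-equivocating nodes whose last block was created at $\langle s-1,f+2\rangle$, and $N_{\mathrm{same}}$ the number of those whose last block has digest $\sigma$. It sets its ELSS indicator to $1$ if two different digests occur in blocks of time $\langle s-2,f+2\rangle$ by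 at least $f+1$ nodes each. If its last final digest is not for slot $s-3$ and it has a last block $B_\ell$, with valid cone, of the (arbitrary) leader of the slot, it also sets the indicator to $1$ if the last DC of the leader in $\mathrm{Cone}(B_\ell)$ certifies a digest conflicting with $\sigma$; it then merges $\mathrm{Cone}(B_\ell)$ and adopts the digest of $B_\ell$ if either $2N_{\mathrm{same}}\le N_{\mathrm{total}}$ and (that digest does not conflict with the one certified by its own last DC, or the leader's last DC is from a slot not before that of its own last DC), or $2N_{\mathrm{same}}>N_{\mathrm{total}}$, the indicator is $1$ and the leader's last DC is from a slot not before that of its own. *If $i=f+2$*, it extends $\sigma=\sigma_{s-2}$ to the digest $\sigma_{s-1}$ computed from its DAG. Whenever its digest changes to $\sigma'$ it sets $\mathrm{Order}_{\mathrm{own}}=\mathrm{Order}(\sigma')$. It then updates its last final digest. 3. It creates a block with its current digest and references to all unreferenced blocks of its DAG, adds it to the DAG and broadcasts it. **Theorem.** Assume that in every slot the number of awake correct nodes is strictly larger than the number of awake Byzantine nodes. Then there is a single backbone chain $\sigma_{-1},\sigma_0,\sigma_1,\dots$, where $\sigma_k$ is a digest for slot $k$ and extends $\sigma_{k-1}$,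 such that the following hold. *Safety.* For every slot $s$, every slot-$s$ awake correct node has $\sigma_{s-2}$ as its adopted digest in the rounds $\langle s,1\rangle,\dots,\langle s,f+1\rangle$, and $\sigma_{s-1}$ in the round $\langle s,f+2\rangle$. For any two correct nodes at any two rounds, one of their sequences $\mathrm{Order}_{\mathrm{own}}$ is a prefix of the other. *Liveness.* Every block created by a correct node at slot $s$ is committed by $\sigma_s$. It is in $\mathrm{Order}_{\mathrm{own}}$ of every slot-$(s+1)$ awake correct node at round $\langle s+1,f+2\rangle$, and of every slot-$t$ awake correct node in every round of slot $t$, for all $t\ge s+2$. -/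

import Mathlib

namespace Slipstream

universe u v

/-! ### Timestamps -/

/-- A timestamp `⟨s, i⟩`: slot `s`, round `i` inside the slot. -/
structure Time where
  slot : ℕ
  round : ℕ

/-- Timestamps are compared lexicographically. -/
instance : LT Time := ⟨fun a b => a.slot < b.slot ∨ (a.slot = b.slot ∧ a.round < b.round)⟩

/-- The timestamps of actual rounds: slots `1, 2, …`, rounds `1, …, f + 2`. -/
def Time.IsRound (f : ℕ) (t : Time) : Prop := 1 ≤ t.slot ∧ 1 ≤ t.round ∧ t.round ≤ f + 2

/-- The preceding timestamp: `⟨s, i - 1⟩` if `i > 1`, and `⟨s - 1, f + 2⟩` otherwise. -/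
def Time.prev (f : ℕ) (t : Time) : Time :=
  if 1 < t.round then ⟨t.slot, t.round - 1⟩ else ⟨t.slot - 1, f + 2⟩

/-! ### Blocks and slot digests

Hashing is the ideal (collision-free) one: a hash is the term that was hashed, so a hash reference
to a block is the block itself, and a digest `Hash(σ, B₁ ‖ B₂ ‖ …)` is the term
`Digest.hash σ [B₁, B₂, …]`.  Signatures are ideal as well; unforgeability is part of the network
model (`Execution.unforgeable`). -/

mutual

/-- Blocks of the DAG; `N` is the type of nodes, `P` the type of payloads (sets of transactions). -/
inductive Block (N : Type u) (P : Type v) : Type (max u v)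
  | genesis : Block N P
  | mk (node : N) (time : Time) (digest : Digest N P) (txs : P) (refs : List (Block N P)) :
      Block N P

/-- Slot digests: `σ₋₁ = 0` and `σₛ = Hash(σₛ₋₁, Concat(Blocks))`. -/
inductive Digest (N : Type u) (P : Type v) : Type (max u v)
  | zero : Digest N P
  | hash (before : Digest N P) (blocks : List (Block N P)) : Digest N P

end

variable {N : Type u} {P : Type v}

noncomputable instance : DecidableEq (Block N P) := Classical.decEq _

/-- The slot for which a digest is constructed. -/
def Digest.slot : Digest N P → ℤ
  | .zero => -1
  | .hash σ _ => σ.slot + 1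

/-- `BeforeCommit`. -/
def Digest.before : Digest N P → Option (Digest N P)
  | .zero => none
  | .hash σ _ => some σ

/-- `Order(σ)`: the sequence of the blocks committed by `σ`. -/
def Digest.order : Digest N P → List (Block N P)
  | .zero => []
  | .hash σ blocks => σ.order ++ blocks

/-- The backbone chain `(σ₋₁, σ₀, …, σ)` that ends in `σ`. -/
def Digest.chain : Digest N P → List (Digest N P)
  | .zero => [.zero]
  | .hash σ blocks => σ.chain ++ [.hash σ blocks]

/-- `IsConflict(θ, σ)`: neither digest lies on the backbone chain of the other. -/
def Digest.Conflict (θ σ : Digest N P) : Prop := θ ∉ σ.chain ∧ σ ∉ θ.chain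

namespace Block

/-- The creator of a block (`Genesis` has none). -/
def node : Block N P → Option N
  | .genesis => none
  | .mk ν _ _ _ _ => some ν

/-- The timestamp of a block; `Genesis` carries `⟨0, f + 2⟩`. -/
def time (f : ℕ) : Block N P → Time
  | .genesis => ⟨0, f + 2⟩
  | .mk _ t _ _ _ => t

def slot : Block N P → ℕ
  | .genesis => 0
  | .mk _ t _ _ _ => t.slot

/-- The digest included in a block. -/
def digest : Block N P → Digest N P
  | .genesis => .zero
  | .mk _ _ σ _ _ => σ

def refs : Block N P → List (Block N P)
  | .genesis => []
  | .mk _ _ _ _ r => r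

/-- `C` is reachable from `B` by following references. -/
def Reaches (B C : Block N P) : Prop :=
  Relation.ReflTransGen (fun X Y : Block N P => Y ∈ X.refs) B C

theorem finite_reaches (B : Block N P) : {C | B.Reaches C}.Finite := by
  have key : ∀ n : ℕ, ∀ B : Block N P, sizeOf B ≤ n → {C | B.Reaches C}.Finite := by
    intro n
    induction n with
    | zero =>
      intro B hB
      cases B <;> simp at hB
    | succ n ih =>
      intro B hB
      have hsub : {C | B.Reaches C} ⊆ {B} ∪ ⋃ X ∈ {X | X ∈ B.refs}, {C | X.Reaches C} := by
        intro C hC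
        rcases Relation.ReflTransGen.cases_head hC with h | ⟨X, hX, hXC⟩
        · left; exact h.symm
        · right
          simp only [Set.mem_iUnion]
          exact ⟨X, hX, hXC⟩
      refine Set.Finite.subset ((Set.finite_singleton B).union ?_) hsub
      refine Set.Finite.biUnion (List.finite_toSet B.refs) ?_
      intro X hX
      apply ih
      cases B with
      | genesis => simp [refs] at hX
      | mk ν t σ p r =>
        have h1 : sizeOf X < sizeOf r := List.sizeOf_lt_of_mem hX
        simp at hB
        omega
  exact key _ B le_rfl

/-- The past cone `Cone(B)`: all blocks reachable from `B`, including `B`. -/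
noncomputable def cone (B : Block N P) : Finset (Block N P) := (finite_reaches B).toFinset

end Block

/-- The equivocators that can be found in a set of blocks: the nodes with two blocks in the set
neither of which is reachable from the other. -/
def eqSet (S : Finset (Block N P)) : Set N :=
  {ν | ∃ B ∈ S, ∃ C ∈ S, B.node = some ν ∧ C.node = some ν ∧ C ∉ B.cone ∧ B ∉ C.cone}

/-- The equivocators that can be found in the DAG of the blocks committed by `σ`. -/
noncomputable def Digest.eqSet (σ : Digest N P) : Set N := Slipstream.eqSet σ.order.toFinset

/-! ### The protocol -/

/-- The parameters of the protocol: the bound `f`, the deterministic rule `concat` that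
orders a finite set of blocks (any rule), and the outcome of `Leader()` for each node
and slot (arbitrary; `none` is `⊥`). -/
structure Protocol (N : Type u) (P : Type v) where
  f : ℕ
  concat : Finset (Block N P) → List (Block N P)
  concat_spec : ∀ S, (concat S : Multiset (Block N P)) = S.val
  leader : N → ℕ → Option N

section protocol

open scoped Classical

/-- `Blocks_{≤ s}`: the blocks of the DAG `D` created at or before slot `s` and not committed
by `σ`. -/
noncomputable def newBlocks (D : Finset (Block N P)) (σ : Digest N P) (s : ℕ) :
    Finset (Block N P) :=
  D.filter fun C => C.slot ≤ s ∧ C ∉ σ.order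

/-- The conditions (graph, time, digest) that validity of a DAG puts on one of its blocks. -/
def BlockOK (Q : Protocol N P) : Block N P → Prop
  | .genesis => True
  | .mk ν t σ p r =>
    r ≠ [] ∧ t.IsRound Q.f ∧ (∀ C ∈ r, C.time Q.f < t) ∧
    (t.round < Q.f + 2 → σ.slot = (t.slot : ℤ) - 2) ∧
    (t.round = Q.f + 2 → σ.slot = (t.slot : ℤ) - 1) ∧
    (t.round ≠ 1 → t.round ≠ Q.f + 2 → ∀ C ∈ r, C.digest = σ) ∧
    (t.round = 1 → (∃ C ∈ r, C.digest = σ) ∧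
      ∀ C ∈ r, ∀ C' ∈ r, C.digest ≠ σ → C'.digest ≠ σ → C.digest = C'.digest) ∧
    (t.round = Q.f + 2 → ∃ θ, (∀ C ∈ r, C.digest = θ) ∧
      σ = .hash θ (Q.concat (newBlocks (Block.mk ν t σ p r).cone θ (t.slot - 1))))

/-- `IsValid(Cone(B))`, as checked by a node with buffer `buf`: all of the cone is known to the
node, and it is graph-, time- and digest-valid. -/
def ValidCone (Q : Protocol N P) (buf : Finset (Block N P)) (B : Block N P) : Prop :=
  B.cone ⊆ buf ∧ ∀ C ∈ B.cone, BlockOK Q C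

/-- `ReachNumber(C, B)`: the number of nodes that created a block in `Cone(B)`, at the slot of `B`,
from which `C` is reachable. -/
noncomputable def reachNumber (C B : Block N P) : ℕ :=
  Set.ncard {ν : N | ∃ E ∈ B.cone, E.slot = B.slot ∧ E.node = some ν ∧ C ∈ E.cone}

/-- `A` is a digest certificate for `σ`: its cone contains blocks of at least `2f + 1` nodes, issued
at the slot of `A`, that include `σ`. -/
def IsDC (f : ℕ) (A : Block N P) (σ : Digest N P) : Prop :=
  (A.slot : ℤ) = σ.slot + 2 ∧
    2 * f + 1 ≤ Set.ncard {ν : N | ∃ B ∈ A.cone, B.slot = A.slot ∧ B.node = some ν ∧ B.digest = σ}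

/-- `B` is a block of `S` with property `p` whose timestamp is latest possible. -/
def IsLatest (f : ℕ) (S : Finset (Block N P)) (p : Block N P → Prop) (B : Block N P) : Prop :=
  B ∈ S ∧ p B ∧ ∀ C ∈ S, p C → ¬ B.time f < C.time f

/-- A latest block of `S` with property `p`, if there is a block with this property. -/
noncomputable def latest (f : ℕ) (S : Finset (Block N P)) (p : Block N P → Prop) :
    Option (Block N P) :=
  if h : ∃ B, IsLatest f S p B then some h.choose else none

/-- `LastBlockFrom(ν)`. -/
noncomputable def lastBlockFrom (f : ℕ) (buf : Finset (Block N P)) (ν : N) : Option (Block N P) :=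
  latest f buf fun B => B.node = some ν

/-- `LastCommitCertificate(B)`: the last digest certificate in `Cone(B)` by the creator of `B`. -/
noncomputable def lastDC (f : ℕ) (B : Block N P) : Option (Block N P) :=
  latest f B.cone fun A => A.node = B.node ∧ ∃ σ, IsDC f A σ

/-- The slot of the last digest certificate; `0` if there is none. -/
noncomputable def lastDCSlot (f : ℕ) (B : Block N P) : ℕ :=
  match lastDC f B with
  | none => 0
  | some A => A.slot

/-- The digest certified by the last digest certificate of `B` conflicts with `θ`
(never the case if there is no certificate). -/
def LastDCConflict (f : ℕ) (B : Block N P) (θ : Digest N P) : Prop :=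
  ∃ A σ, lastDC f B = some A ∧ IsDC f A σ ∧ σ.Conflict θ

/-- The local state of a node.  `digest` is the last element of the adopted backbone chain, which
is then `digest.chain`. -/
structure NodeState (N : Type u) (P : Type v) where
  dag : Finset (Block N P)
  digest : Digest N P
  orderOwn : List (Block N P)
  own : Option (Block N P)
  sFinal : ℕ
  elss : Prop

def NodeState.initial : NodeState N P where
  dag := {.genesis}
  digest := .zero
  orderOwn := [.genesis]
  own := none
  sFinal := 0
  elss := False

/-- The blocks inspected by `UpdateDAG()` at round `t`. -/
noncomputable def candidates (Q : Protocol N P) (t : Time) (buf : Finset (Block N P))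
    (σ : Digest N P) : Finset (Block N P) :=
  buf.filter fun B => B.cone ⊆ buf ∧ B.time Q.f = t.prev Q.f ∧ B.digest = σ ∧
    ∀ ν, B.node = some ν → ν ∉ eqSet buf

/-- The test that `UpdateDAG()` performs on a candidate `B` when the DAG is `D`. -/
def Accepts (Q : Protocol N P) (t : Time) (buf : Finset (Block N P)) (σ : Digest N P)
    (D : Finset (Block N P)) (B : Block N P) : Prop :=
  (∀ C ∈ B.cone, C.slot = t.slot → ∀ ν, C.node = some ν → ν ∉ σ.eqSet) ∧
  (∀ C ∈ B.cone, C ∉ D → C.slot < t.slot → C ∉ σ.order → t.round - 1 ≤ reachNumber C B) ∧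
  ValidCone Q buf B

/-- `UpdateDAG()`: the candidates are processed one after the other, in any order. -/
def UpdateDAG (Q : Protocol N P) (t : Time) (buf : Finset (Block N P))
    (st st' : NodeState N P) : Prop :=
  if st.own.map (Block.time Q.f) = some (t.prev Q.f) then
    ∃ L : List (Block N P), (L : Multiset (Block N P)) = (candidates Q t buf st.digest).val ∧
      st' = { st with
        dag := L.foldl
          (fun D B => if Accepts Q t buf st.digest D B then D ∪ B.cone else D) st.dag }
  else st' = st

/-- The digest in the last block of node `ν`, if that block was created at the last round of
slot `s` and `ν` is not a known equivocator. -/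
noncomputable def vote (f : ℕ) (buf : Finset (Block N P)) (s : ℕ) (ν : N) :
    Option (Digest N P) :=
  if ν ∈ eqSet buf then none
  else (lastBlockFrom f buf ν).bind fun B =>
    if B.time f = ⟨s, f + 2⟩ then some B.digest else none

/-- The number of (non-equivocating) nodes whose last block, created at the last round of slot `s`,
includes `σ`. -/
noncomputable def numVotes (f : ℕ) (buf : Finset (Block N P)) (s : ℕ) (σ : Digest N P) : ℕ :=
  Set.ncard {ν : N | vote f buf s ν = some σ}

/-- The number of (non-equivocating) nodes whose last block was created at the last round of
slot `s`. -/
noncomputable def numTotal (f : ℕ) (buf : Finset (Block N P)) (s : ℕ) : ℕ :=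
  Set.ncard {ν : N | (vote f buf s ν).isSome}

/-- `CheckELSS()`: two different digests are supported by at least `f + 1` nodes each in blocks
created at the last round of slot `s`. -/
def ELSSDetected (f : ℕ) (buf : Finset (Block N P)) (s : ℕ) : Prop :=
  ∃ σ θ : Digest N P, σ ≠ θ ∧ ∀ ρ, ρ = σ ∨ ρ = θ →
    f + 1 ≤ Set.ncard {ν : N | ∃ B ∈ buf, B.node = some ν ∧ B.time f = ⟨s, f + 2⟩ ∧ B.digest = ρ}

/-- Merge the past cone of `B` and adopt its digest. -/
noncomputable def NodeState.adopt (st : NodeState N P) (B : Block N P) : NodeState N P :=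
  { st with dag := st.dag ∪ B.cone, digest := B.digest, orderOwn := B.digest.order }

/-- `SwitchChain()`, run at round `⟨s, 1⟩` by a node that was awake at slot `s - 1`. -/
noncomputable def switchChain (Q : Protocol N P) (η : N) (s : ℕ) (buf : Finset (Block N P))
    (st : NodeState N P) : NodeState N P :=
  let st₁ := { st with elss := st.elss ∨ ELSSDetected Q.f buf (s - 2) }
  match (Q.leader η s).bind (lastBlockFrom Q.f buf), st.own with
  | some B, some own =>
    if st.sFinal + 3 ≠ s ∧ ValidCone Q buf B then
      let st₂ := { st₁ with elss := st₁.elss ∨ LastDCConflict Q.f B own.digest }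
      if 2 * numVotes Q.f buf (s - 1) st.digest ≤ numTotal Q.f buf (s - 1) then
        if ¬ LastDCConflict Q.f own B.digest ∨ lastDCSlot Q.f own ≤ lastDCSlot Q.f B then
          st₂.adopt B
        else st₂
      else if st₂.elss ∧ lastDCSlot Q.f own ≤ lastDCSlot Q.f B then st₂.adopt B
      else st₂
    else st₁
  | _, _ => st₁

/-- `WakeUpChain()`, run at round `⟨s, 1⟩` by a node that was asleep at slot `s - 1`: adopt a most
frequent digest (ties are broken in any way) and merge the valid cones of the last blocks with this
digest.  Without any vote nothing is changed. -/
def WakeUpChain (Q : Protocol N P) (s : ℕ) (buf : Finset (Block N P))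
    (st st' : NodeState N P) : Prop :=
  (∃ σ : Digest N P, 0 < numVotes Q.f buf (s - 1) σ ∧
    (∀ θ, numVotes Q.f buf (s - 1) θ ≤ numVotes Q.f buf (s - 1) σ) ∧
    st' = { st with
      digest := σ
      orderOwn := σ.order
      dag := st.dag ∪ (buf.filter fun B => B.digest = σ ∧ ValidCone Q buf B ∧
        ∃ ν, ν ∉ eqSet buf ∧ lastBlockFrom Q.f buf ν = some B).biUnion Block.cone }) ∨
  ((∀ σ, numVotes Q.f buf (s - 1) σ = 0) ∧ st' = st)

/-- `UpdateChain()`, run at round `⟨s, f + 2⟩`: append the digest for slot `s - 1`. -/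
noncomputable def updateChain (Q : Protocol N P) (s : ℕ) (st : NodeState N P) : NodeState N P :=
  let σ := Digest.hash st.digest (Q.concat (newBlocks st.dag st.digest (s - 1)))
  { st with digest := σ, orderOwn := σ.order }

/-- The digest for slot `k` on the backbone chain of the node is final: its DAG contains digest
certificates for it by at least `2f + 1` nodes. -/
def IsFinal (f : ℕ) (st : NodeState N P) (k : ℕ) : Prop :=
  ∃ σ ∈ st.digest.chain, σ.slot = k ∧
    2 * f + 1 ≤ Set.ncard {ν : N | ∃ A ∈ st.dag, A.node = some ν ∧ IsDC f A σ}

/-- `FinalizeSlots()` at slot `s`, as far as it concerns `s_final`. -/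
noncomputable def finalizeSlots (f s : ℕ) (st : NodeState N P) : NodeState N P :=
  { st with
    sFinal := max st.sFinal
      (((Finset.Icc (st.sFinal + 3) s).filter fun t => IsFinal f st (t - 2)).sup fun t => t - 2) }

/-- `Tips()`: the blocks of the DAG that no block of the DAG references. -/
noncomputable def tips (D : Finset (Block N P)) : Finset (Block N P) :=
  D.filter fun B => ∀ C ∈ D, B ∉ C.refs

/-- `CreateBlock()` at round `t`, with any payload, the current digest, and references to
all tips. -/
def CreateBlock (η : N) (t : Time) (st st' : NodeState N P) : Prop :=
  ∃ (p : P) (r : List (Block N P)), (r : Multiset (Block N P)) = (tips st.dag).val ∧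
    st' = { st with
      dag := insert (Block.mk η t st.digest p r) st.dag
      own := some (Block.mk η t st.digest p r) }

/-- The state update phase of round `t` at node `η`, where `buf` is its buffer after the receive
phase.  At the very first round only a block is created. -/
def StateUpdate (Q : Protocol N P) (η : N) (t : Time) (wasAwake : Prop)
    (buf : Finset (Block N P)) (st st' : NodeState N P) : Prop :=
  ∃ st₁ st₂ : NodeState N P,
    UpdateDAG Q t buf st st₁ ∧
    (if t.round = 1 then
      if t.slot = 1 then st₂ = st₁
      else if wasAwake then st₂ = switchChain Q η t.slot buf st₁
      else WakeUpChain Q t.slot buf st₁ st₂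
    else if t.round = Q.f + 2 then st₂ = updateChain Q t.slot st₁
    else st₂ = st₁) ∧
    CreateBlock η t (finalizeSlots Q.f t.slot st₂) st'

end protocol

/-! ### Executions in the slot-sleepy model -/

/-- An execution of the protocol in the slot-sleepy model.  `awake s ν` says that `ν` is slot-`s`
awake.  For a correct node `η` and a round `t`, `buffer η t` is its buffer after the receive
phase, and `state η t` its state after the state update phase, of round `t`; the block broadcast in
the send phase is `(state η t).own`.  Nothing is prescribed for Byzantine nodes: subject to the
conditions below, the buffers may contain arbitrary blocks of theirs. -/
structure Execution (Q : Protocol N P) where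
  correct : N → Prop
  awake : ℕ → N → Prop
  buffer : N → Time → Finset (Block N P)
  state : N → Time → NodeState N P
  /-- The initial state. -/
  init : ∀ η, correct η →
    state η ⟨0, Q.f + 2⟩ = .initial ∧ buffer η ⟨0, Q.f + 2⟩ = {.genesis}
  /-- Asleep nodes have no phases. -/
  asleep : ∀ η t, correct η → t.IsRound Q.f → ¬ awake t.slot η →
    state η t = state η (t.prev Q.f) ∧ buffer η t = buffer η (t.prev Q.f)
  /-- Awake correct nodes follow the protocol. -/
  follows : ∀ η t, correct η → t.IsRound Q.f → awake t.slot η →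
    StateUpdate Q η t (awake (t.slot - 1) η) (buffer η t) (state η (t.prev Q.f)) (state η t)
  /-- Received blocks are kept. -/
  buffer_mono : ∀ η t, correct η → t.IsRound Q.f → buffer η (t.prev Q.f) ⊆ buffer η t
  /-- Lock-step synchrony: what a correct node broadcasts at a round, a block together with its
  past cone, is received at the next round by every correct node awake then. -/
  delivery : ∀ η μ t B, correct η → correct μ → t.IsRound Q.f → awake t.slot η →
    (t.prev Q.f).IsRound Q.f → awake (t.prev Q.f).slot μ →
    (state μ (t.prev Q.f)).own = some B → B.cone ⊆ buffer η t
  /-- The block of a correct node is accompanied by proofs of the equivocations it knows of. -/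
  proofs : ∀ η μ t, correct η → correct μ → t.IsRound Q.f → awake t.slot η →
    (t.prev Q.f).IsRound Q.f → awake (t.prev Q.f).slot μ →
    eqSet (buffer μ (t.prev Q.f)) ⊆ eqSet (buffer η t)
  /-- Blocks with a timestamp that is not in the past are not accepted into the buffer. -/
  not_future : ∀ η t B, correct η → t.IsRound Q.f → B ∈ buffer η t → B.time Q.f < t
  /-- Signatures of correct nodes cannot be forged. -/
  unforgeable : ∀ η t B μ, correct η → t.IsRound Q.f → B ∈ buffer η t →
    B.node = some μ → correct μ →
    ∃ t', t' < t ∧ t'.IsRound Q.f ∧ awake t'.slot μ ∧ (state μ t').own = some B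
  /-- Asleep nodes issue no blocks: a block with a slot-`s` timestamp that has been received by
  the first round of slot `s + 1` was issued by a slot-`s` awake node.  (Byzantine nodes may still
  release such blocks late or backdate blocks later on.) -/
  issuer_awake : ∀ η t B ν, correct η → t.IsRound Q.f → B ∈ buffer η t → B.node = some ν →
    (t.slot = B.slot ∨ (t.slot = B.slot + 1 ∧ t.round = 1)) → awake B.slot ν

/-- The number of slot-`s` awake correct nodes. -/
noncomputable def Execution.numAwakeCorrect {Q : Protocol N P} (E : Execution Q) (s : ℕ) : ℕ :=
  Set.ncard {ν : N | E.correct ν ∧ E.awake s ν}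

/-- The number of slot-`s` awake Byzantine nodes. -/
noncomputable def Execution.numAwakeByzantine {Q : Protocol N P} (E : Execution Q) (s : ℕ) : ℕ :=
  Set.ncard {ν : N | ¬ E.correct ν ∧ E.awake s ν}

end Slipstream

/-!
The agreed digests are `Execution.backbone`, with `backbone n` the digest for slot `n - 1`, and
`Execution.SlotOK s` collects what awake correct nodes satisfy in slot `s`. It is proved by strong
induction on `s`; safety and liveness can be read off from it.

*Between two slots no correct node leaves the chain.* All correct nodes awake in slot `s - 1` end it
with the same digest and vote for it. Only nodes awake in that slot can vote, and most of them are
correct, so this digest has an absolute majority (`Execution.numTotal_lt`), and it is the one that a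
waking node adopts. The ELSS indicator is never set: both `f + 1` supporters of a digest and the `2f + 1` nodes behind a
digest certificate include a correct node, so only agreed digests are supported or certified
(`Execution.not_elssDetected`, `Execution.not_lastDCConflict`). With an absolute majority and no
ELSS, `SwitchChain()` does nothing (`Execution.switchChain_eq`).

*Inside a slot all correct nodes collect the same old blocks.* An uncommitted block `C` of an earlier
slot that a correct node adds in round `i` is supported by `i - 1` nodes, and by the node itself in
the block it then creates, so all correct nodes add `C` in round `i + 1` (`Execution.InSlot.updated`,
`Execution.InSlot.succ`). If `C` is added in the last round, then one of its `f + 1` supporters is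
correct, and its broadcast has already brought `C` to everyone (`Execution.Updated.agreement`).
Hence all correct nodes compute the same next digest.

*Correct blocks are always accepted.* The DAG of a correct node is closed under references, so
the cone of its newest block is its whole DAG (`Execution.dag_eq_cone`); in particular correct nodes do
not equivocate (`Execution.not_mem_eqSet`). Every block of the DAG lies below a block with
the current digest (`TopDigest`), so all tips carry this digest and the new block is valid. As DAGs
are exchanged completely between slots, a correct block of slot `s` is in every correct DAG when the digest for
slot `s` is computed, which gives liveness.
-/

namespace Slipstream

universe u v

variable {N : Type u} {P : Type v}

/-! ### Rounds -/

theorem Time.lt_def {a b : Time} :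
    a < b ↔ a.slot < b.slot ∨ (a.slot = b.slot ∧ a.round < b.round) := Iff.rfl

theorem Time.prev_one (f s : ℕ) : Time.prev f ⟨s, 1⟩ = ⟨s - 1, f + 2⟩ := by
  simp [Time.prev]

theorem Time.prev_succ (f s : ℕ) {i : ℕ} (hi : 1 ≤ i) : Time.prev f ⟨s, i + 1⟩ = ⟨s, i⟩ := by
  have : 1 < i + 1 := by omega
  simp [Time.prev, this]

theorem Time.lt_trichotomy (a b : Time) : a < b ∨ a = b ∨ b < a := by
  obtain ⟨s, i⟩ := a
  obtain ⟨s', i'⟩ := b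
  simp only [Time.lt_def, Time.mk.injEq]
  omega

/-- Induction along the sequence of all rounds, starting from the fictitious round `⟨0, f + 2⟩`. -/
theorem Time.round_induction (f : ℕ) {p : Time → Prop} (h0 : p ⟨0, f + 2⟩)
    (hs : ∀ t : Time, t.IsRound f → p (t.prev f) → p t) : ∀ t : Time, t.IsRound f → p t := by
  have key : ∀ s i : ℕ, 1 ≤ i → i ≤ f + 2 → 1 ≤ s → p ⟨s, i⟩ := by
    intro s
    induction s with
    | zero => intro i _ _ h; omega
    | succ s ihs =>
      intro i
      induction i with
      | zero => intro h; omega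
      | succ i ihi =>
        intro _ hi _
        refine hs ⟨s + 1, i + 1⟩ ⟨by simp, by simp, hi⟩ ?_
        rcases Nat.eq_zero_or_pos i with rfl | hpos
        · rw [Time.prev_one]
          rcases Nat.eq_zero_or_pos s with rfl | hs'
          · exact h0
          · exact ihs (f + 2) (by omega) le_rfl hs'
        · rw [Time.prev_succ f _ hpos]
          exact ihi hpos (by omega) (by omega)
  intro t ht
  exact key t.slot t.round ht.2.1 ht.2.2 ht.1

theorem Time.lt_prev_or_eq {f : ℕ} {a b : Time} (ha : a.IsRound f) (hb : b.IsRound f)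
    (hab : a < b) : a < b.prev f ∨ a = b.prev f := by
  obtain ⟨s, i⟩ := a
  obtain ⟨s', i'⟩ := b
  obtain ⟨h1, h2, h3⟩ := ha
  obtain ⟨h4, h5, h6⟩ := hb
  simp only at h1 h2 h3 h4 h5 h6
  unfold Time.prev
  split_ifs with h
  · simp only [Time.lt_def, Time.mk.injEq] at *
    omega
  · simp only [Time.lt_def, Time.mk.injEq] at *
    omega

theorem Time.prev_lt {f : ℕ} {t : Time} (ht : t.IsRound f) : t.prev f < t := by
  obtain ⟨s, i⟩ := t
  obtain ⟨h1, h2, h3⟩ := ht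
  simp only at h1 h2 h3
  unfold Time.prev
  split_ifs with h
  · exact Or.inr ⟨rfl, Nat.sub_lt h2 one_pos⟩
  · exact Or.inl (Nat.sub_lt h1 one_pos)

theorem Time.lt_trans {a b c : Time} (h : a < b) (h' : b < c) : a < c := by
  simp only [Time.lt_def] at *
  omega

/-! ### Cones, closed sets of blocks, and tips -/

namespace Block

theorem mem_cone {B C : Block N P} : C ∈ B.cone ↔ B.Reaches C := by
  simp [cone]

theorem self_mem_cone (B : Block N P) : B ∈ B.cone := mem_cone.2 .refl

theorem cone_subset {B C : Block N P} (h : C ∈ B.cone) : C.cone ⊆ B.cone := fun _ hX =>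
  mem_cone.2 ((mem_cone.1 h).trans (mem_cone.1 hX))

theorem mem_cone_of_mem_refs {B C : Block N P} (h : C ∈ B.refs) : C ∈ B.cone :=
  mem_cone.2 (.single h)

theorem sizeOf_lt_of_mem_refs {B C : Block N P} (h : C ∈ B.refs) : sizeOf C < sizeOf B := by
  cases B with
  | genesis => simp [refs] at h
  | mk ν t σ p r =>
    have h1 : sizeOf C < sizeOf r := List.sizeOf_lt_of_mem h
    simp only [mk.sizeOf_spec]
    omega

theorem slot_eq_time_slot (f : ℕ) (B : Block N P) : B.slot = (B.time f).slot := by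
  cases B <;> rfl

end Block

/-- A set of blocks that contains the past cone of each of its blocks. -/
def Closed (D : Finset (Block N P)) : Prop := ∀ B ∈ D, B.cone ⊆ D

/-- Every block of `D` lies in the cone of a block of `D` with digest `d`. -/
def TopDigest (d : Digest N P) (D : Finset (Block N P)) : Prop :=
  ∀ C ∈ D, ∃ T ∈ D, C ∈ T.cone ∧ T.digest = d

theorem mem_tips {D : Finset (Block N P)} {B : Block N P} :
    B ∈ tips D ↔ B ∈ D ∧ ∀ C ∈ D, B ∉ C.refs := by
  simp [tips]

theorem closed_singleton_genesis : Closed ({.genesis} : Finset (Block N P)) := by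
  intro B hB C hC
  rw [Finset.mem_singleton] at hB ⊢
  subst hB
  rcases Relation.ReflTransGen.cases_head (Block.mem_cone.1 hC) with h | ⟨X, hX, -⟩
  · exact h.symm
  · simp [Block.refs] at hX

theorem exists_tip {D : Finset (Block N P)} {C : Block N P} (hC : C ∈ D) :
    ∃ T ∈ tips D, C ∈ T.cone := by
  -- a block of maximal size among those of `D` that reach `C` is a tip
  have hne : (D.filter fun X => C ∈ X.cone).Nonempty :=
    ⟨C, Finset.mem_filter.2 ⟨hC, C.self_mem_cone⟩⟩
  obtain ⟨T, hT, hmax⟩ := Finset.exists_max_image _ (fun X : Block N P => sizeOf X) hne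
  obtain ⟨hTD, hCT⟩ := Finset.mem_filter.1 hT
  refine ⟨T, mem_tips.2 ⟨hTD, fun X hX hTX => ?_⟩, hCT⟩
  have h1 := hmax X (Finset.mem_filter.2
    ⟨hX, Block.cone_subset (Block.mem_cone_of_mem_refs hTX) hCT⟩)
  have h2 := Block.sizeOf_lt_of_mem_refs hTX
  omega

/-- A block that references the tips of a closed set has exactly this set as its proper past. -/
theorem cone_mk_tips {D : Finset (Block N P)} (hD : Closed D) {ν : N} {t : Time}
    {d : Digest N P} {p : P} {r : List (Block N P)}
    (hr : (r : Multiset (Block N P)) = (tips D).val) :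
    (Block.mk ν t d p r).cone = insert (Block.mk ν t d p r) D := by
  have hmem : ∀ X, X ∈ r ↔ X ∈ tips D := fun X => by
    rw [← Multiset.mem_coe, hr, Finset.mem_val]
  ext C
  rw [Block.mem_cone, Finset.mem_insert]
  constructor
  · intro h
    rcases Relation.ReflTransGen.cases_head h with h | ⟨X, hX, hXC⟩
    · exact Or.inl h.symm
    · exact Or.inr (hD X (mem_tips.1 ((hmem X).1 hX)).1 (Block.mem_cone.2 hXC))
  · rintro (rfl | hC)
    · exact .refl
    · obtain ⟨T, hT, hCT⟩ := exists_tip hC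
      exact .head ((hmem T).2 hT) (Block.mem_cone.1 hCT)

theorem TopDigest.digest_of_mem_tips {d : Digest N P} {D : Finset (Block N P)} (hD : Closed D)
    (h : TopDigest d D) {T : Block N P} (hT : T ∈ tips D) : T.digest = d := by
  obtain ⟨hTD, hno⟩ := mem_tips.1 hT
  obtain ⟨X, hX, hTX, rfl⟩ := h T hTD
  rcases Relation.ReflTransGen.cases_tail (Block.mem_cone.1 hTX) with h | ⟨Y, hXY, hYT⟩
  · rw [h]
  · exact absurd hYT (hno Y (hD X hX (Block.mem_cone.2 hXY)))

theorem Closed.insert_own {D : Finset (Block N P)} (hD : Closed D) {B : Block N P}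
    (hB : B.cone = insert B D) : Closed (insert B D) := by
  intro C hC
  rcases Finset.mem_insert.1 hC with rfl | hC
  · exact hB.le
  · exact (hD C hC).trans (Finset.subset_insert _ _)

/-! ### Validity of the blocks that the protocol creates -/

theorem mem_newBlocks {D : Finset (Block N P)} {σ : Digest N P} {s : ℕ} {C : Block N P} :
    C ∈ newBlocks D σ s ↔ C ∈ D ∧ C.slot ≤ s ∧ C ∉ σ.order := by
  simp [newBlocks]

theorem mem_concat (Q : Protocol N P) {S : Finset (Block N P)} {C : Block N P} :
    C ∈ Q.concat S ↔ C ∈ S := by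
  rw [← Multiset.mem_coe, Q.concat_spec, Finset.mem_val]

theorem blockOK_mk_of_round_lt {Q : Protocol N P} {D : Finset (Block N P)} {η : N} {t : Time}
    {d : Digest N P} {p : P} {r : List (Block N P)} (hD : Closed D) (hne : D.Nonempty)
    (hr : (r : Multiset (Block N P)) = (tips D).val) (ht : t.IsRound Q.f)
    (htime : ∀ C ∈ D, C.time Q.f < t) (htop : TopDigest d D) (hround : t.round < Q.f + 2)
    (hd : d.slot = (t.slot : ℤ) - 2) : BlockOK Q (.mk η t d p r) := by
  have hmem : ∀ X, X ∈ r ↔ X ∈ tips D := fun X => by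
    rw [← Multiset.mem_coe, hr, Finset.mem_val]
  obtain ⟨C, hC⟩ := hne
  obtain ⟨T, hT, -⟩ := exists_tip hC
  have hdig : ∀ X ∈ r, X.digest = d := fun X hX => htop.digest_of_mem_tips hD ((hmem X).1 hX)
  refine ⟨List.ne_nil_of_mem ((hmem T).2 hT), ht,
    fun X hX => htime X (mem_tips.1 ((hmem X).1 hX)).1, fun _ => hd, fun h => by omega,
    fun _ _ => hdig, fun _ => ⟨⟨T, (hmem T).2 hT, hdig T ((hmem T).2 hT)⟩, ?_⟩,
    fun h => by omega⟩
  intro X hX _ _ h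
  exact absurd (hdig X hX) h

theorem blockOK_mk_of_round_eq {Q : Protocol N P} {D : Finset (Block N P)} {η : N} {s : ℕ}
    {θ : Digest N P} {p : P} {r : List (Block N P)} (hD : Closed D) (hne : D.Nonempty)
    (hr : (r : Multiset (Block N P)) = (tips D).val) (hs : 1 ≤ s)
    (htime : ∀ C ∈ D, C.time Q.f < ⟨s, Q.f + 2⟩) (htop : TopDigest θ D)
    (hθ : θ.slot = (s : ℤ) - 2) :
    BlockOK Q (.mk η ⟨s, Q.f + 2⟩ (.hash θ (Q.concat (newBlocks D θ (s - 1)))) p r) := by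
  have hmem : ∀ X, X ∈ r ↔ X ∈ tips D := fun X => by
    rw [← Multiset.mem_coe, hr, Finset.mem_val]
  obtain ⟨C, hC⟩ := hne
  obtain ⟨T, hT, -⟩ := exists_tip hC
  have hdig : ∀ X ∈ r, X.digest = θ := fun X hX => htop.digest_of_mem_tips hD ((hmem X).1 hX)
  refine ⟨List.ne_nil_of_mem ((hmem T).2 hT), ⟨hs, by simp, le_rfl⟩,
    fun X hX => htime X (mem_tips.1 ((hmem X).1 hX)).1, fun h => by simp at h, fun _ => ?_,
    fun _ h => by simp at h, fun h => by simp at h, fun _ => ⟨θ, hdig, ?_⟩⟩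
  · simp only [Digest.slot, hθ]; ring
  · -- the block itself belongs to slot `s`, so it does not contribute to its own digest
    congr 2
    rw [cone_mk_tips hD hr]
    ext X
    simp only [mem_newBlocks, Finset.mem_insert]
    constructor
    · rintro ⟨h1, h2⟩; exact ⟨Or.inr h1, h2⟩
    · rintro ⟨rfl | h1, h2, h3⟩
      · simp only [Block.slot] at h2; omega
      · exact ⟨h1, h2, h3⟩

/-! ### Growth of a local DAG -/

/-- `D'` arises from `D` by merging past cones that are completely contained in `buf`. -/
def Grows (buf D D' : Finset (Block N P)) : Prop :=
  D ⊆ D' ∧ ∀ C ∈ D', C ∉ D → ∃ B : Block N P, C ∈ B.cone ∧ B.cone ⊆ buf ∧ B.cone ⊆ D'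

theorem Grows.refl (buf D : Finset (Block N P)) : Grows buf D D :=
  ⟨subset_rfl, fun _ h h' => absurd h h'⟩

theorem Grows.trans {buf D D' D'' : Finset (Block N P)} (h : Grows buf D D')
    (h' : Grows buf D' D'') : Grows buf D D'' := by
  refine ⟨h.1.trans h'.1, fun C hC hCD => ?_⟩
  by_cases hC' : C ∈ D'
  · obtain ⟨B, h1, h2, h3⟩ := h.2 C hC' hCD
    exact ⟨B, h1, h2, h3.trans h'.1⟩
  · exact h'.2 C hC hC'

theorem Grows.closed {buf D D' : Finset (Block N P)} (h : Grows buf D D') (hD : Closed D) :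
    Closed D' := by
  intro C hC
  by_cases hCD : C ∈ D
  · exact (hD C hCD).trans h.1
  · obtain ⟨B, h1, -, h3⟩ := h.2 C hC hCD
    exact (Block.cone_subset h1).trans h3

theorem Grows.mem_or {buf D D' : Finset (Block N P)} (h : Grows buf D D') {C : Block N P}
    (hC : C ∈ D') : C ∈ D ∨ C ∈ buf := by
  by_cases hCD : C ∈ D
  · exact Or.inl hCD
  · obtain ⟨B, h1, h2, -⟩ := h.2 C hC hCD
    exact Or.inr (h2 h1)

theorem grows_union_cone {buf D : Finset (Block N P)} {B : Block N P} (hB : B.cone ⊆ buf) :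
    Grows buf D (D ∪ B.cone) := by
  refine ⟨Finset.subset_union_left, fun C hC hCD => ⟨B, ?_, hB, Finset.subset_union_right⟩⟩
  exact (Finset.mem_union.1 hC).resolve_left hCD

theorem mem_candidates {Q : Protocol N P} {t : Time} {buf : Finset (Block N P)}
    {σ : Digest N P} {B : Block N P} :
    B ∈ candidates Q t buf σ ↔ B ∈ buf ∧ B.cone ⊆ buf ∧ B.time Q.f = t.prev Q.f ∧
      B.digest = σ ∧ ∀ ν, B.node = some ν → ν ∉ eqSet buf := by
  simp [candidates]

theorem Accepts.mono {Q : Protocol N P} {t : Time} {buf : Finset (Block N P)}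
    {σ : Digest N P} {D D' : Finset (Block N P)} {B : Block N P}
    (h : Accepts Q t buf σ D B) (hD : D ⊆ D') : Accepts Q t buf σ D' B :=
  ⟨h.1, fun C hC hCD => h.2.1 C hC fun hC' => hCD (hD hC'), h.2.2⟩

section fold
open scoped Classical

theorem updateDAG_fold (Q : Protocol N P) (t : Time) (buf : Finset (Block N P))
    (σ : Digest N P) (L : List (Block N P)) (D : Finset (Block N P)) :
    let D' := L.foldl (fun D B => if Accepts Q t buf σ D B then D ∪ B.cone else D) D
    D ⊆ D' ∧
    (∀ C ∈ D', C ∉ D → ∃ B ∈ L, ∃ X, C ∉ X ∧ Accepts Q t buf σ X B ∧ C ∈ B.cone ∧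
      B.cone ⊆ D') ∧
    ∀ B ∈ L, Accepts Q t buf σ D B → B.cone ⊆ D' := by
  induction L generalizing D with
  | nil => exact ⟨subset_rfl, fun C h h' => absurd h h', fun B hB => by simp at hB⟩
  | cons A L ih =>
    simp only [List.foldl_cons]
    set D₁ := if Accepts Q t buf σ D A then D ∪ A.cone else D with hD₁
    obtain ⟨h1, h2, h3⟩ := ih D₁
    have hsub : D ⊆ D₁ := by
      rw [hD₁]; split_ifs
      · exact Finset.subset_union_left
      · exact subset_rfl
    refine ⟨hsub.trans h1, fun C hC hCD => ?_, fun B hB hacc => ?_⟩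
    · by_cases hC₁ : C ∈ D₁
      · by_cases hA : Accepts Q t buf σ D A
        · rw [if_pos hA] at hD₁
          have hCA : C ∈ A.cone := by
            rw [hD₁] at hC₁
            exact (Finset.mem_union.1 hC₁).resolve_left hCD
          refine ⟨A, by simp, D, hCD, hA, hCA, ?_⟩
          refine Finset.Subset.trans ?_ h1
          rw [hD₁]
          exact Finset.subset_union_right
        · rw [hD₁, if_neg hA] at hC₁
          exact absurd hC₁ hCD
      · obtain ⟨B, hB, X, h⟩ := h2 C hC hC₁
        exact ⟨B, List.mem_cons_of_mem _ hB, X, h⟩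
    · rcases List.mem_cons.1 hB with rfl | hB
      · refine Finset.Subset.trans ?_ h1
        rw [hD₁, if_pos hacc]
        exact Finset.subset_union_right
      · exact h3 B hB (hacc.mono hsub)

end fold

/-- Everything that is needed about `UpdateDAG()`: only the DAG changes; every new block comes with
an accepted candidate, tested when the block was still missing; and every candidate that passes
the test against the initial DAG is merged. -/
theorem UpdateDAG.spec {Q : Protocol N P} {t : Time} {buf : Finset (Block N P)}
    {st st' : NodeState N P} (h : UpdateDAG Q t buf st st') :
    st' = { st with dag := st'.dag } ∧ st.dag ⊆ st'.dag ∧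
    (∀ C ∈ st'.dag, C ∉ st.dag → ∃ B ∈ candidates Q t buf st.digest, ∃ X, C ∉ X ∧
      Accepts Q t buf st.digest X B ∧ C ∈ B.cone ∧ B.cone ⊆ st'.dag) ∧
    (st.own.map (Block.time Q.f) = some (t.prev Q.f) →
      ∀ B ∈ candidates Q t buf st.digest, Accepts Q t buf st.digest st.dag B →
        B.cone ⊆ st'.dag) := by
  unfold UpdateDAG at h
  split_ifs at h with hown
  · obtain ⟨L, hL, rfl⟩ := h
    have hmem : ∀ X, X ∈ L ↔ X ∈ candidates Q t buf st.digest := fun X => by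
      rw [← Multiset.mem_coe, hL, Finset.mem_val]
    obtain ⟨h1, h2, h3⟩ := updateDAG_fold Q t buf st.digest L st.dag
    refine ⟨rfl, h1, fun C hC hCD => ?_, fun _ B hB => h3 B ((hmem B).2 hB)⟩
    obtain ⟨B, hB, h⟩ := h2 C hC hCD
    exact ⟨B, (hmem B).1 hB, h⟩
  · subst h
    exact ⟨rfl, subset_rfl, fun C h h' => absurd h h', fun h => absurd h hown⟩

theorem UpdateDAG.grows {Q : Protocol N P} {t : Time} {buf : Finset (Block N P)}
    {st st' : NodeState N P} (h : UpdateDAG Q t buf st st') : Grows buf st.dag st'.dag := by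
  obtain ⟨-, h1, h2, -⟩ := h.spec
  refine ⟨h1, fun C hC hCD => ?_⟩
  obtain ⟨B, hB, X, -, -, hCB, hsub⟩ := h2 C hC hCD
  exact ⟨B, hCB, (mem_candidates.1 hB).2.1, hsub⟩

theorem switchChain_grows (Q : Protocol N P) (η : N) (s : ℕ) (buf : Finset (Block N P))
    (st : NodeState N P) : Grows buf st.dag (switchChain Q η s buf st).dag := by
  unfold switchChain
  dsimp only
  split
  · split_ifs with h1 h2 h3 h3
    · exact grows_union_cone h1.2.1
    · exact .refl _ _
    · exact grows_union_cone h1.2.1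
    · exact .refl _ _
    · exact .refl _ _
  · exact .refl _ _

open scoped Classical in
theorem WakeUpChain.grows {Q : Protocol N P} {s : ℕ} {buf : Finset (Block N P)}
    {st st' : NodeState N P} (h : WakeUpChain Q s buf st st') : Grows buf st.dag st'.dag := by
  rcases h with ⟨σ, -, -, rfl⟩ | ⟨-, rfl⟩
  · refine ⟨Finset.subset_union_left, fun C hC hCD => ?_⟩
    have hC' := (Finset.mem_union.1 hC).resolve_left hCD
    obtain ⟨B, hB, hCB⟩ := Finset.mem_biUnion.1 hC'
    refine ⟨B, hCB, (Finset.mem_filter.1 hB).2.2.1.1, fun X hX => ?_⟩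
    exact Finset.mem_union_right _ (Finset.mem_biUnion.2 ⟨B, hB, hX⟩)
  · exact .refl _ _

/-! ### Latest blocks and the backbone chain -/

theorem isLatest_of_latest_eq_some {f : ℕ} {S : Finset (Block N P)} {p : Block N P → Prop}
    {B : Block N P} (h : latest f S p = some B) : IsLatest f S p B := by
  unfold latest at h
  split_ifs at h with h'
  rw [← Option.some.inj h]
  exact h'.choose_spec

theorem latest_eq_some {f : ℕ} {S : Finset (Block N P)} {p : Block N P → Prop} {B : Block N P}
    (hB : IsLatest f S p B) (huniq : ∀ C, IsLatest f S p C → C = B) :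
    latest f S p = some B := by
  have hex : ∃ B, IsLatest f S p B := ⟨B, hB⟩
  unfold latest
  rw [dif_pos hex, huniq _ hex.choose_spec]

theorem Digest.mem_chain_self (σ : Digest N P) : σ ∈ σ.chain := by
  cases σ <;> simp [Digest.chain]

/-! ### Executions: facts that do not depend on agreement -/

namespace Execution

variable {Q : Protocol N P} (E : Execution Q)

/-- If the creator of `B` is a correct node, then it broadcast `B` in some round in which it was
awake. -/
def Issued (B : Block N P) : Prop :=
  ∀ μ, B.node = some μ → E.correct μ →
    ∃ t : Time, t.IsRound Q.f ∧ E.awake t.slot μ ∧ (E.state μ t).own = some B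

open scoped Classical in
/-- The effect of a round at an awake correct node, in terms of the states after `UpdateDAG()` and
before the creation of the block. -/
theorem round_spec {η : N} {t : Time} (hη : E.correct η) (ht : t.IsRound Q.f)
    (ha : E.awake t.slot η) :
    ∃ (st₁ st₂ : NodeState N P) (p : P) (r : List (Block N P)),
      UpdateDAG Q t (E.buffer η t) (E.state η (t.prev Q.f)) st₁ ∧
      (if t.round = 1 then
        if t.slot = 1 then st₂ = st₁
        else if E.awake (t.slot - 1) η then st₂ = switchChain Q η t.slot (E.buffer η t) st₁
        else WakeUpChain Q t.slot (E.buffer η t) st₁ st₂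
      else if t.round = Q.f + 2 then st₂ = updateChain Q t.slot st₁
      else st₂ = st₁) ∧
      (r : Multiset (Block N P)) = (tips st₂.dag).val ∧
      (E.state η t).dag = insert (Block.mk η t st₂.digest p r) st₂.dag ∧
      (E.state η t).digest = st₂.digest ∧
      (E.state η t).orderOwn = st₂.orderOwn ∧
      (E.state η t).elss = st₂.elss ∧
      (E.state η t).own = some (Block.mk η t st₂.digest p r) := by
  obtain ⟨st₁, st₂, h1, h2, p, r, hr, h3⟩ := E.follows η t hη ht ha
  refine ⟨st₁, st₂, p, r, h1, ?_, hr, ?_⟩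
  · split_ifs at h2 ⊢ <;> exact h2
  · rw [h3]
    refine ⟨?_, rfl, rfl, rfl, rfl⟩
    ext; simp [finalizeSlots]

theorem round_grows {η : N} {t : Time} (hη : E.correct η) (ht : t.IsRound Q.f)
    (ha : E.awake t.slot η) :
    ∃ (D : Finset (Block N P)) (d : Digest N P) (p : P) (r : List (Block N P)),
      Grows (E.buffer η t) (E.state η (t.prev Q.f)).dag D ∧
      (r : Multiset (Block N P)) = (tips D).val ∧
      (E.state η t).dag = insert (Block.mk η t d p r) D ∧
      (E.state η t).digest = d ∧
      (E.state η t).own = some (Block.mk η t d p r) := by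
  obtain ⟨st₁, st₂, p, r, h1, h2, hr, hdag, hd, -, -, hown⟩ := E.round_spec hη ht ha
  refine ⟨st₂.dag, st₂.digest, p, r, h1.grows.trans ?_, hr, hdag, hd, hown⟩
  split_ifs at h2
  · rw [h2]; exact .refl _ _
  · rw [h2]; exact switchChain_grows _ _ _ _ _
  · exact h2.grows
  · rw [h2]; exact .refl _ _
  · rw [h2]; exact .refl _ _

theorem issued_of_mem_buffer {η : N} {t : Time} {B : Block N P} (hη : E.correct η)
    (ht : t.IsRound Q.f) (hB : B ∈ E.buffer η t) : E.Issued B := fun μ hμ hc => by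
  obtain ⟨t', -, h1, h2, h3⟩ := E.unforgeable η t B μ hη ht hB hμ hc
  exact ⟨t', h1, h2, h3⟩

theorem own_node_time {η : N} {t : Time} (hη : E.correct η) (ht : t.IsRound Q.f)
    (ha : E.awake t.slot η) {B : Block N P} (hB : (E.state η t).own = some B) :
    B.node = some η ∧ B.time Q.f = t ∧ B.digest = (E.state η t).digest ∧
      B ∈ (E.state η t).dag ∧ B ≠ .genesis := by
  obtain ⟨D, d, p, r, -, -, h3, h4, h5⟩ := E.round_grows hη ht ha
  rw [h5] at hB
  obtain rfl := Option.some.inj hB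
  refine ⟨rfl, rfl, h4.symm, ?_, by simp⟩
  rw [h3]; exact Finset.mem_insert_self _ _

theorem exists_own {η : N} {t : Time} (hη : E.correct η) (ht : t.IsRound Q.f)
    (ha : E.awake t.slot η) : ∃ B, (E.state η t).own = some B := by
  obtain ⟨D, d, p, r, -, -, -, -, h5⟩ := E.round_grows hη ht ha
  exact ⟨_, h5⟩

/-- Invariants of the local DAG of a correct node. -/
theorem dag_invariant {η : N} (hη : E.correct η) (t : Time) (ht : t.IsRound Q.f) :
    Closed (E.state η t).dag ∧ Block.genesis ∈ (E.state η t).dag ∧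
    (∀ C ∈ (E.state η t).dag, C.time Q.f < t ∨ C.time Q.f = t) ∧
    ∀ C ∈ (E.state η t).dag, E.Issued C := by
  refine Time.round_induction Q.f (p := fun t =>
    Closed (E.state η t).dag ∧ Block.genesis ∈ (E.state η t).dag ∧
    (∀ C ∈ (E.state η t).dag, C.time Q.f < t ∨ C.time Q.f = t) ∧
    ∀ C ∈ (E.state η t).dag, E.Issued C) ?_ ?_ t ht
  · rw [(E.init η hη).1]
    refine ⟨closed_singleton_genesis, by simp [NodeState.initial], ?_, ?_⟩
    · intro C hC
      simp only [NodeState.initial, Finset.mem_singleton] at hC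
      subst hC
      exact Or.inr rfl
    · intro C hC μ hμ
      simp only [NodeState.initial, Finset.mem_singleton] at hC
      subst hC
      simp [Block.node] at hμ
  · intro t ht ⟨ih1, ih2, ih3, ih4⟩
    by_cases ha : E.awake t.slot η
    · obtain ⟨D, d, p, r, h1, h2, h3, h4, h5⟩ := E.round_grows hη ht ha
      have hD := h1.closed ih1
      rw [h3]
      refine ⟨hD.insert_own (cone_mk_tips hD h2), Finset.mem_insert_of_mem (h1.1 ih2), ?_, ?_⟩
      · intro C hC
        rcases Finset.mem_insert.1 hC with rfl | hC
        · exact Or.inr rfl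
        · left
          rcases h1.mem_or hC with h | h
          · rcases ih3 C h with h | h
            · exact Time.lt_trans h (Time.prev_lt ht)
            · rw [h]; exact Time.prev_lt ht
          · exact E.not_future η t C hη ht h
      · intro C hC
        rcases Finset.mem_insert.1 hC with rfl | hC
        · intro μ hμ _
          obtain rfl := Option.some.inj hμ
          exact ⟨t, ht, ha, h5⟩
        · rcases h1.mem_or hC with h | h
          · exact ih4 C h
          · exact E.issued_of_mem_buffer hη ht h
    · rw [(E.asleep η t hη ht ha).1]
      refine ⟨ih1, ih2, fun C hC => ?_, ih4⟩
      rcases ih3 C hC with h | h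
      · exact Or.inl (Time.lt_trans h (Time.prev_lt ht))
      · rw [h]; exact Or.inl (Time.prev_lt ht)

/-- The state before a round, which may be the initial one, has a closed DAG that contains
`Genesis` and only blocks from the past. -/
theorem dag_closed_prev {η : N} (hη : E.correct η) {t : Time} (ht : t.IsRound Q.f) :
    Closed (E.state η (t.prev Q.f)).dag ∧ Block.genesis ∈ (E.state η (t.prev Q.f)).dag ∧
    (∀ C ∈ (E.state η (t.prev Q.f)).dag, C.time Q.f < t) := by
  by_cases hp : (t.prev Q.f).IsRound Q.f
  · obtain ⟨h1, h2, h3, -⟩ := E.dag_invariant hη _ hp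
    refine ⟨h1, h2, fun C hC => ?_⟩
    rcases h3 C hC with h | h
    · exact Time.lt_trans h (Time.prev_lt ht)
    · rw [h]; exact Time.prev_lt ht
  · have hprev : t.prev Q.f = ⟨0, Q.f + 2⟩ := by
      obtain ⟨s, i⟩ := t
      obtain ⟨h1, h2, h3⟩ := ht
      simp only at h1 h2 h3
      unfold Time.prev Time.IsRound at *
      split_ifs at * with h
      · simp only at h hp; omega
      · simp only at h hp
        have : s = 1 := by omega
        simp [this]
    rw [hprev, (E.init η hη).1]
    refine ⟨closed_singleton_genesis, by simp [NodeState.initial], ?_⟩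
    · intro C hC
      simp only [NodeState.initial, Finset.mem_singleton] at hC
      subst hC
      exact Or.inl ht.1

/-- The DAG of an awake correct node is the cone of the block that it has just created. -/
theorem dag_eq_cone {η : N} {t : Time} (hη : E.correct η) (ht : t.IsRound Q.f)
    (ha : E.awake t.slot η) {B : Block N P} (hB : (E.state η t).own = some B) :
    (E.state η t).dag = B.cone := by
  obtain ⟨D, d, p, r, h1, h2, h3, h4, h5⟩ := E.round_grows hη ht ha
  rw [h5] at hB
  obtain rfl := Option.some.inj hB
  rw [h3, cone_mk_tips (h1.closed (E.dag_closed_prev hη ht).1) h2]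

theorem dag_prev_subset {η : N} {t : Time} (hη : E.correct η) (ht : t.IsRound Q.f) :
    (E.state η (t.prev Q.f)).dag ⊆ (E.state η t).dag := by
  by_cases ha : E.awake t.slot η
  · obtain ⟨D, d, p, r, h1, h2, h3, h4, h5⟩ := E.round_grows hη ht ha
    rw [h3]
    exact h1.1.trans (Finset.subset_insert _ _)
  · rw [(E.asleep η t hη ht ha).1]

theorem dag_mono {η : N} (hη : E.correct η) {a b : Time} (ha : a.IsRound Q.f)
    (hb : b.IsRound Q.f) (hab : a < b ∨ a = b) : (E.state η a).dag ⊆ (E.state η b).dag := by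
  refine Time.round_induction Q.f (p := fun b => ∀ a : Time, a.IsRound Q.f → a < b ∨ a = b →
    (E.state η a).dag ⊆ (E.state η b).dag) ?_ ?_ b hb a ha hab
  · intro a ha hab
    exfalso
    have h1 := ha.1
    have h2 := ha.2.2
    rcases hab with h | rfl
    · simp only [Time.lt_def] at h; omega
    · simp at h1
  · intro t ht ih a ha hab
    rcases hab with h | rfl
    · exact (ih a ha (Time.lt_prev_or_eq ha ht h)).trans (E.dag_prev_subset hη ht)
    · exact subset_rfl

/-- Each block of a correct node references its earlier ones, so correct nodes never equivocate. -/
theorem not_mem_eqSet {S : Finset (Block N P)} (hS : ∀ C ∈ S, E.Issued C) {μ : N}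
    (hμ : E.correct μ) : μ ∉ eqSet S := by
  rintro ⟨B, hB, C, hC, hBμ, hCμ, h1, h2⟩
  obtain ⟨t, ht, hta, hto⟩ := hS B hB μ hBμ hμ
  obtain ⟨t', ht', hta', hto'⟩ := hS C hC μ hCμ hμ
  have hBt := E.own_node_time hμ ht hta hto
  have hCt := E.own_node_time hμ ht' hta' hto'
  rcases Time.lt_trichotomy t t' with h | rfl | h
  · apply h2
    rw [← E.dag_eq_cone hμ ht' hta' hto']
    exact E.dag_mono hμ ht ht' (Or.inl h) hBt.2.2.2.1
  · rw [hto] at hto'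
    obtain rfl := Option.some.inj hto'
    exact h1 B.self_mem_cone
  · apply h1
    rw [← E.dag_eq_cone hμ ht hta hto]
    exact E.dag_mono hμ ht' ht (Or.inl h) hCt.2.2.2.1

theorem not_mem_eqSet_buffer {η μ : N} {t : Time} (hη : E.correct η) (ht : t.IsRound Q.f)
    (hμ : E.correct μ) : μ ∉ eqSet (E.buffer η t) :=
  E.not_mem_eqSet (fun _ hC => E.issued_of_mem_buffer hη ht hC) hμ

/-- An asleep correct node keeps its state through the whole slot. -/
theorem state_asleep {η : N} (hη : E.correct η) {s : ℕ} (hs : 1 ≤ s) (ha : ¬ E.awake s η) {i : ℕ}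
    (hi : 1 ≤ i) (hif : i ≤ Q.f + 2) : E.state η ⟨s, i⟩ = E.state η ⟨s - 1, Q.f + 2⟩ := by
  induction i, hi using Nat.le_induction with
  | base => rw [(E.asleep η ⟨s, 1⟩ hη ⟨hs, le_rfl, hif⟩ ha).1, Time.prev_one]
  | succ i hi ihi =>
    rw [(E.asleep η ⟨s, i + 1⟩ hη ⟨hs, by simp, hif⟩ ha).1, Time.prev_succ _ _ hi]
    exact ihi (by omega)

/-- A correct node that enters slot `s` is in its initial state or in the state in which it left the
last slot in which it was awake. -/
theorem state_before_slot {η : N} (hη : E.correct η) (s : ℕ) :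
    E.state η ⟨s, Q.f + 2⟩ = .initial ∨
      ∃ r, 1 ≤ r ∧ r ≤ s ∧ E.awake r η ∧ E.state η ⟨s, Q.f + 2⟩ = E.state η ⟨r, Q.f + 2⟩ := by
  induction s with
  | zero => exact Or.inl (E.init η hη).1
  | succ s ih =>
    by_cases ha : E.awake (s + 1) η
    · exact Or.inr ⟨s + 1, by omega, le_rfl, ha, rfl⟩
    · rw [E.state_asleep hη (by omega) ha (by omega) le_rfl, Nat.add_sub_cancel]
      rcases ih with h | ⟨r, h1, h2, h3, h4⟩
      · exact Or.inl h
      · exact Or.inr ⟨r, h1, by omega, h3, h4⟩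

end Execution

/-! ### The backbone chain and its invariants in a slot -/

namespace Execution

variable {Q : Protocol N P} (E : Execution Q)

open scoped Classical in
/-- The agreed digests, with indices shifted by one: `backbone n` is the digest for slot `n - 1`. It
is read off from an arbitrary awake correct node at the last round of slot `n`. -/
noncomputable def backbone : ℕ → Digest N P
  | 0 => .zero
  | n + 1 =>
    if h : ∃ η, E.correct η ∧ E.awake (n + 1) η then (E.state h.choose ⟨n + 1, Q.f + 2⟩).digest
    else .zero

theorem exists_backbone_eq {s : ℕ} (hs : 1 ≤ s) (h : ∃ η, E.correct η ∧ E.awake s η) :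
    ∃ η, E.correct η ∧ E.awake s η ∧ (E.state η ⟨s, Q.f + 2⟩).digest = E.backbone s := by
  obtain ⟨n, rfl⟩ : ∃ n, s = n + 1 := ⟨s - 1, by omega⟩
  refine ⟨h.choose, h.choose_spec.1, h.choose_spec.2, ?_⟩
  rw [backbone, dif_pos h]

/-- The sequence `Order_own` of an awake correct node in the first `f + 1` rounds of slot `s`. In
slot `1` it still has the initial value, which is not `Order(0)`. -/
noncomputable def earlyOrder (s : ℕ) : List (Block N P) :=
  if s = 1 then [.genesis] else (E.backbone (s - 1)).order

/-- What all awake correct nodes satisfy in slot `s`. -/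
structure SlotOK (s : ℕ) : Prop where
  early : ∀ η, E.correct η → E.awake s η → ∀ i : ℕ, 1 ≤ i → i ≤ Q.f + 1 →
    (E.state η ⟨s, i⟩).digest = E.backbone (s - 1) ∧
    (E.state η ⟨s, i⟩).orderOwn = E.earlyOrder s
  late : ∀ η, E.correct η → E.awake s η →
    (E.state η ⟨s, Q.f + 2⟩).digest = E.backbone s ∧
    (E.state η ⟨s, Q.f + 2⟩).orderOwn = (E.backbone s).order ∧
    ¬ (E.state η ⟨s, Q.f + 2⟩).elss ∧
    ∀ C ∈ (E.state η ⟨s, Q.f + 2⟩).dag, BlockOK Q C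
  /-- The digest is the one computed by some awake correct node. -/
  computed : ∃ η, E.correct η ∧ E.awake s η ∧ E.backbone s = .hash (E.backbone (s - 1))
    (Q.concat (newBlocks (E.state η ⟨s, Q.f + 2⟩).dag (E.backbone (s - 1)) (s - 1)))
  issued : ∀ C ∈ (E.backbone s).order, E.Issued C
  /-- The blocks that correct nodes created in earlier slots are in all DAGs and get committed. -/
  prior : ∀ η, E.correct η → E.awake s η → ∀ μ t B, E.correct μ → t.IsRound Q.f →
    E.awake t.slot μ → t.slot < s → (E.state μ t).own = some B →
    B ∈ (E.state η ⟨s, Q.f + 2⟩).dag ∧ B ∈ (E.backbone s).order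

variable {E} in
theorem SlotOK.extend {s : ℕ} (h : E.SlotOK s) :
    ∃ l, E.backbone s = .hash (E.backbone (s - 1)) l := by
  obtain ⟨η, -, -, h⟩ := h.computed
  exact ⟨_, h⟩

theorem slot_backbone {s : ℕ} (hp : ∀ r, 1 ≤ r → r ≤ s → E.SlotOK r) :
    (E.backbone s).slot = (s : ℤ) - 1 := by
  induction s with
  | zero => simp [backbone, Digest.slot]
  | succ s ih =>
    obtain ⟨l, hl⟩ := (hp (s + 1) (by omega) le_rfl).extend
    rw [hl, Digest.slot, Nat.add_sub_cancel, ih fun r h1 h2 => hp r h1 (by omega)]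
    push_cast; ring

theorem issued_backbone {s : ℕ} (hp : ∀ r, 1 ≤ r → r ≤ s → E.SlotOK r) {C : Block N P}
    (hC : C ∈ (E.backbone s).order) : E.Issued C := by
  rcases Nat.eq_zero_or_pos s with rfl | hs
  · simp [backbone, Digest.order] at hC
  · exact (hp s hs le_rfl).issued C hC

theorem not_mem_eqSet_backbone {s : ℕ} (hp : ∀ r, 1 ≤ r → r ≤ s → E.SlotOK r) {μ : N}
    (hμ : E.correct μ) : μ ∉ (E.backbone s).eqSet :=
  E.not_mem_eqSet (fun _ hC => E.issued_backbone hp (List.mem_toFinset.1 hC)) hμ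

theorem mem_chain_backbone {m n : ℕ} (hmn : m ≤ n) (hp : ∀ r, 1 ≤ r → r ≤ n → E.SlotOK r) :
    E.backbone m ∈ (E.backbone n).chain := by
  induction n, hmn using Nat.le_induction with
  | base => exact Digest.mem_chain_self _
  | succ n hmn ih =>
    obtain ⟨l, hl⟩ := (hp (n + 1) (by omega) le_rfl).extend
    rw [hl, Nat.add_sub_cancel, Digest.chain]
    exact List.mem_append_left _ (ih fun r h1 h2 => hp r h1 (by omega))

theorem order_backbone_prefix {m n : ℕ} (hmn : m ≤ n) (hp : ∀ r, 1 ≤ r → r ≤ n → E.SlotOK r) :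
    (E.backbone m).order <+: (E.backbone n).order := by
  induction n, hmn using Nat.le_induction with
  | base => exact List.prefix_rfl
  | succ n hmn ih =>
    obtain ⟨l, hl⟩ := (hp (n + 1) (by omega) le_rfl).extend
    rw [hl, Nat.add_sub_cancel, Digest.order]
    exact (ih fun r h1 h2 => hp r h1 (by omega)).trans (List.prefix_append _ _)

/-- A block of a correct node carries the agreed digest. -/
theorem digest_own {μ : N} {t : Time} (hp : E.SlotOK t.slot) (hμ : E.correct μ)
    (ht : t.IsRound Q.f) (ha : E.awake t.slot μ) {B : Block N P}
    (hB : (E.state μ t).own = some B) :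
    B.digest = E.backbone (if t.round = Q.f + 2 then t.slot else t.slot - 1) := by
  rw [(E.own_node_time hμ ht ha hB).2.2.1]
  obtain ⟨s, i⟩ := t
  split_ifs with h
  · simp only at h
    subst h
    exact (hp.late μ hμ ha).1
  · have h3 := ht.2.2
    simp only at h h3
    exact (hp.early μ hμ ha i ht.2.1 (by omega)).1

/-! ### Votes at the beginning of a slot -/

section entry

variable {s : ℕ} {η : N}

theorem isRound_first (hs : 1 ≤ s) : Time.IsRound Q.f ⟨s, 1⟩ := ⟨hs, le_rfl, by simp⟩

theorem isRound_last (hs : 1 ≤ s) : Time.IsRound Q.f ⟨s, Q.f + 2⟩ := ⟨hs, by simp, le_rfl⟩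

theorem cone_subset_buffer_first (hs : 2 ≤ s) (hη : E.correct η) (ha : E.awake s η) {μ : N}
    (hμ : E.correct μ) (hμa : E.awake (s - 1) μ) {B : Block N P}
    (hB : (E.state μ ⟨s - 1, Q.f + 2⟩).own = some B) : B.cone ⊆ E.buffer η ⟨s, 1⟩ := by
  have hprev := Time.prev_one Q.f s
  refine E.delivery η μ ⟨s, 1⟩ B hη hμ (isRound_first (by omega)) ha ?_ ?_ ?_
  · rw [hprev]; exact isRound_last (by omega)
  · rw [hprev]; exact hμa
  · rw [hprev]; exact hB

theorem lastBlockFrom_correct (hs : 2 ≤ s) (hη : E.correct η) (ha : E.awake s η) {μ : N}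
    (hμ : E.correct μ) (hμa : E.awake (s - 1) μ) {B : Block N P}
    (hB : (E.state μ ⟨s - 1, Q.f + 2⟩).own = some B) :
    lastBlockFrom Q.f (E.buffer η ⟨s, 1⟩) μ = some B := by
  have hround : Time.IsRound Q.f ⟨s - 1, Q.f + 2⟩ := isRound_last (by omega)
  obtain ⟨h1, h2, -, -, -⟩ := E.own_node_time hμ hround hμa hB
  have hmem := E.cone_subset_buffer_first hs hη ha hμ hμa hB B.self_mem_cone
  have hbuf : ∀ C ∈ E.buffer η ⟨s, 1⟩, C.node = some μ → ∃ t : Time, t.IsRound Q.f ∧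
      t < ⟨s, 1⟩ ∧ C.time Q.f = t ∧ (E.state μ t).own = some C := by
    intro C hC hCμ
    obtain ⟨t, ht, hr, hta, hto⟩ :=
      E.unforgeable η ⟨s, 1⟩ C μ hη (isRound_first (by omega)) hC hCμ hμ
    exact ⟨t, hr, ht, (E.own_node_time hμ hr hta hto).2.1, hto⟩
  refine latest_eq_some ⟨hmem, h1, fun C hC hCμ hlt => ?_⟩ fun C ⟨hC, hCμ, hmax⟩ => ?_
  · obtain ⟨t, hr, ht, hCt, -⟩ := hbuf C hC hCμ
    have h3 := hr.2.1
    have h4 := hr.2.2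
    rw [h2, hCt] at hlt
    simp only [Time.lt_def] at hlt ht
    omega
  · obtain ⟨t, hr, ht, hCt, hto⟩ := hbuf C hC hCμ
    have hnot := hmax B hmem h1
    rw [h2, hCt] at hnot
    have ht' : t = ⟨s - 1, Q.f + 2⟩ := by
      obtain ⟨a, b⟩ := t
      have h1 := hr.2.1
      have h2 := hr.2.2
      simp only [Time.lt_def, Time.mk.injEq] at *
      omega
    subst ht'
    rw [hB] at hto
    exact (Option.some.inj hto).symm

theorem vote_correct (hs : 2 ≤ s) (hη : E.correct η) (ha : E.awake s η) {μ : N}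
    (hμ : E.correct μ) (hμa : E.awake (s - 1) μ) :
    vote Q.f (E.buffer η ⟨s, 1⟩) (s - 1) μ =
      some (E.state μ ⟨s - 1, Q.f + 2⟩).digest := by
  have hround : Time.IsRound Q.f ⟨s - 1, Q.f + 2⟩ := isRound_last (by omega)
  obtain ⟨B, hB⟩ := E.exists_own hμ hround hμa
  obtain ⟨-, h2, h3, -, -⟩ := E.own_node_time hμ hround hμa hB
  unfold vote
  rw [if_neg (E.not_mem_eqSet_buffer hη (isRound_first (by omega)) hμ),
    E.lastBlockFrom_correct hs hη ha hμ hμa hB, Option.bind_some, if_pos h2, h3]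

theorem awake_of_vote (hs : 2 ≤ s) (hη : E.correct η) {ν : N}
    (hν : (vote Q.f (E.buffer η ⟨s, 1⟩) (s - 1) ν).isSome) : E.awake (s - 1) ν := by
  unfold vote at hν
  split_ifs at hν with h1
  · simp at hν
  · obtain ⟨d, hd⟩ := Option.isSome_iff_exists.1 hν
    obtain ⟨B, hB, hBd⟩ := Option.bind_eq_some_iff.1 hd
    split_ifs at hBd with h2
    have hlast := isLatest_of_latest_eq_some hB
    have hslot : B.slot = s - 1 := by rw [B.slot_eq_time_slot Q.f, h2]
    have := E.issuer_awake η ⟨s, 1⟩ B ν hη (isRound_first (by omega)) hlast.1 hlast.2.1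
      (Or.inr ⟨by simp only [hslot]; omega, rfl⟩)
    rwa [hslot] at this

variable [Finite N]

/-- The agreed digest has an absolute majority among the votes. -/
theorem numTotal_lt (hmaj : E.numAwakeByzantine (s - 1) < E.numAwakeCorrect (s - 1))
    (hs : 2 ≤ s) (hp : E.SlotOK (s - 1)) (hη : E.correct η) (ha : E.awake s η) :
    numTotal Q.f (E.buffer η ⟨s, 1⟩) (s - 1) <
      2 * numVotes Q.f (E.buffer η ⟨s, 1⟩) (s - 1) (E.backbone (s - 1)) := by
  have h1 : E.numAwakeCorrect (s - 1) ≤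
      numVotes Q.f (E.buffer η ⟨s, 1⟩) (s - 1) (E.backbone (s - 1)) := by
    refine Set.ncard_le_ncard (fun μ hμ => ?_) (Set.toFinite _)
    rw [Set.mem_ofPred_eq, E.vote_correct hs hη ha hμ.1 hμ.2, (hp.late μ hμ.1 hμ.2).1]
  have h2 : numTotal Q.f (E.buffer η ⟨s, 1⟩) (s - 1) ≤
      E.numAwakeCorrect (s - 1) + E.numAwakeByzantine (s - 1) := by
    refine (Set.ncard_le_ncard (fun ν hν => ?_) (Set.toFinite _)).trans (Set.ncard_union_le _ _)
    have := E.awake_of_vote hs hη hν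
    by_cases hc : E.correct ν
    · exact Or.inl ⟨hc, this⟩
    · exact Or.inr ⟨hc, this⟩
  omega

theorem eq_backbone_of_votes (hmaj : E.numAwakeByzantine (s - 1) < E.numAwakeCorrect (s - 1))
    (hs : 2 ≤ s) (hp : E.SlotOK (s - 1)) (hη : E.correct η) (ha : E.awake s η) {d : Digest N P}
    (hd : numVotes Q.f (E.buffer η ⟨s, 1⟩) (s - 1) (E.backbone (s - 1)) ≤
      numVotes Q.f (E.buffer η ⟨s, 1⟩) (s - 1) d) : d = E.backbone (s - 1) := by
  by_contra hne
  have h1 := E.numTotal_lt hmaj hs hp hη ha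
  have h2 : numVotes Q.f (E.buffer η ⟨s, 1⟩) (s - 1) d +
      numVotes Q.f (E.buffer η ⟨s, 1⟩) (s - 1) (E.backbone (s - 1)) ≤
      numTotal Q.f (E.buffer η ⟨s, 1⟩) (s - 1) := by
    unfold numVotes numTotal
    rw [← Set.ncard_union_eq]
    · refine Set.ncard_le_ncard ?_ (Set.toFinite _)
      rintro ν (hν | hν) <;> rw [Set.mem_ofPred_eq] at hν ⊢ <;> simp [hν]
    · rw [Set.disjoint_left]
      intro ν h h'
      rw [Set.mem_ofPred_eq] at h h'
      rw [h] at h'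
      exact hne (Option.some.inj h')
  omega

theorem exists_correct_of_lt_ncard (hbyz : Set.ncard {ν : N | ¬ E.correct ν} ≤ Q.f) {S : Set N}
    (hS : Q.f + 1 ≤ S.ncard) : ∃ ν ∈ S, E.correct ν := by
  by_contra! h
  have : S.ncard ≤ Set.ncard {ν : N | ¬ E.correct ν} := Set.ncard_le_ncard h (Set.toFinite _)
  omega

/-- Two digests with `f + 1` supporters each would both be supported by correct nodes. -/
theorem not_elssDetected (hbyz : Set.ncard {ν : N | ¬ E.correct ν} ≤ Q.f)
    (hp : ∀ r, 1 ≤ r → r < s → E.SlotOK r) (hη : E.correct η) (hs : 2 ≤ s) :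
    ¬ ELSSDetected Q.f (E.buffer η ⟨s, 1⟩) (s - 2) := by
  rintro ⟨d, θ, hne, h⟩
  have key : ∀ ρ, ρ = d ∨ ρ = θ → ρ = E.backbone (s - 2) := by
    intro ρ hρ
    obtain ⟨ν, ⟨B, hB, hBν, hBt, hBd⟩, hν⟩ := E.exists_correct_of_lt_ncard hbyz (h ρ hρ)
    obtain ⟨t, ht, hta, hto⟩ :=
      E.issued_of_mem_buffer hη (isRound_first (by omega)) hB ν hBν hν
    have htime := (E.own_node_time hν ht hta hto).2.1
    rw [hBt] at htime
    subst htime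
    have := E.digest_own (hp _ ht.1 (by simp only; omega)) hν ht hta hto
    rw [← hBd, this]
    simp
  exact hne ((key d (Or.inl rfl)).trans (key θ (Or.inr rfl)).symm)

/-- A digest certificate contains the vote of a correct node, hence certifies an agreed digest. -/
theorem not_lastDCConflict (hbyz : Set.ncard {ν : N | ¬ E.correct ν} ≤ Q.f)
    (hp : ∀ r, 1 ≤ r → r < s → E.SlotOK r) (hη : E.correct η) (hs : 2 ≤ s) {B : Block N P}
    (hB : B.cone ⊆ E.buffer η ⟨s, 1⟩) : ¬ LastDCConflict Q.f B (E.backbone (s - 1)) := by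
  rintro ⟨A, θ, hA, hDC, hconf, -⟩
  have hAB := (isLatest_of_latest_eq_some hA).1
  obtain ⟨ν, ⟨C, hC, -, hCν, hCd⟩, hν⟩ := E.exists_correct_of_lt_ncard hbyz
    (le_trans (by omega) hDC.2)
  have hround : Time.IsRound Q.f ⟨s, 1⟩ := isRound_first (by omega)
  obtain ⟨t, htlt, ht, hta, hto⟩ := E.unforgeable η ⟨s, 1⟩ C ν hη hround
    (hB (Block.cone_subset hAB hC)) hCν hν
  have hts : t.slot < s := by
    have := ht.2.1
    simp only [Time.lt_def] at htlt
    omega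
  have := E.digest_own (hp _ ht.1 hts) hν ht hta hto
  rw [hCd] at this
  apply hconf
  rw [this]
  exact E.mem_chain_backbone (by split_ifs <;> omega) fun r h1 h2 => hp r h1 (by omega)

/-- A node that was awake in the preceding slot keeps its chain. -/
theorem switchChain_eq (hbyz : Set.ncard {ν : N | ¬ E.correct ν} ≤ Q.f)
    (hmaj : E.numAwakeByzantine (s - 1) < E.numAwakeCorrect (s - 1))
    (hp : ∀ r, 1 ≤ r → r < s → E.SlotOK r) (hη : E.correct η) (hs : 2 ≤ s) (ha : E.awake s η)
    {st : NodeState N P} (hd : st.digest = E.backbone (s - 1)) (helss : ¬ st.elss)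
    (hown : ∀ B, st.own = some B → B.digest = E.backbone (s - 1)) :
    switchChain Q η s (E.buffer η ⟨s, 1⟩) st = { st with elss := False } := by
  have h1 := E.not_elssDetected hbyz hp hη hs
  have h2 := E.numTotal_lt hmaj hs (hp (s - 1) (by omega) (by omega)) hη ha
  have h3 : st.elss = False := by simpa using helss
  unfold switchChain
  dsimp only
  split
  · next B own _ ho =>
    split_ifs with h4 h5 h6 h7
    · rw [hd] at h5; omega
    · rw [hd] at h5; omega
    · have hc := E.not_lastDCConflict hbyz hp hη hs h4.2.1
      rw [hown own ho] at h7
      simp [h1, hc, h3] at h7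
    · have hc := E.not_lastDCConflict hbyz hp hη hs h4.2.1
      rw [hown own ho]
      simp [h1, hc, h3]
    · simp [h1, h3]
  · simp [h1, h3]

end entry

end Execution

/-! ### The first round of a slot -/

namespace Execution

variable {Q : Protocol N P} (E : Execution Q)

variable {s : ℕ} {η : N}

theorem time_lt_of_grows {t : Time} (hη : E.correct η) (ht : t.IsRound Q.f)
    {D : Finset (Block N P)} (hD : Grows (E.buffer η t) (E.state η (t.prev Q.f)).dag D) :
    ∀ C ∈ D, C.time Q.f < t := fun C hC => by
  rcases hD.mem_or hC with h | h
  · exact (E.dag_closed_prev hη ht).2.2 C h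
  · exact E.not_future η t C hη ht h

theorem slot_lt_of_time_lt {C : Block N P} (h : C.time Q.f < ⟨s, 1⟩) (hC : BlockOK Q C)
    (hs : 1 ≤ s) : C.slot < s := by
  rw [C.slot_eq_time_slot Q.f]
  cases C with
  | genesis => exact hs
  | mk ν t d p r =>
    have := hC.2.1.2.1
    simp only [Block.time, Time.lt_def] at *
    omega

/-- What the state of an awake correct node looks like in the first round of slot `s`; `D` is its DAG
before it creates its block. -/
structure Enters (s : ℕ) (η : N) (D : Finset (Block N P)) (p : P) (r : List (Block N P)) :
    Prop where
  tips : (r : Multiset (Block N P)) = (tips D).val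
  grows : Grows (E.buffer η ⟨s, 1⟩) (E.state η ⟨s - 1, Q.f + 2⟩).dag D
  dag : (E.state η ⟨s, 1⟩).dag = insert (Block.mk η ⟨s, 1⟩ (E.backbone (s - 1)) p r) D
  own : (E.state η ⟨s, 1⟩).own = some (Block.mk η ⟨s, 1⟩ (E.backbone (s - 1)) p r)
  digest : (E.state η ⟨s, 1⟩).digest = E.backbone (s - 1)
  order : (E.state η ⟨s, 1⟩).orderOwn = E.earlyOrder s
  elss : ¬ (E.state η ⟨s, 1⟩).elss
  ok : ∀ C ∈ D, BlockOK Q C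
  top : TopDigest (E.backbone (s - 1)) D
  incl : 2 ≤ s → ∀ μ, E.correct μ → E.awake (s - 1) μ →
    (E.state μ ⟨s - 1, Q.f + 2⟩).dag ⊆ D

theorem eq_of_updateDAG_of_own_ne {t : Time} {buf : Finset (Block N P)} {st st' : NodeState N P}
    (h : UpdateDAG Q t buf st st')
    (hown : st.own.map (Block.time Q.f) ≠ some (t.prev Q.f)) : st' = st := by
  unfold UpdateDAG at h
  rwa [if_neg hown] at h

theorem enters_one (hη : E.correct η) (ha : E.awake 1 η) : ∃ D p r, E.Enters 1 η D p r := by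
  have hround : Time.IsRound Q.f ⟨1, 1⟩ := isRound_first le_rfl
  obtain ⟨st₁, st₂, p, r, h1, h2, hr, hdag, hd, ho, he, hown⟩ := E.round_spec hη hround ha
  rw [Time.prev_one, (E.init η hη).1] at h1
  have h3 := eq_of_updateDAG_of_own_ne h1 (by simp [NodeState.initial])
  simp only [if_true] at h2
  rw [h2, h3] at hr hdag hd ho he hown
  have hb : E.backbone (1 - 1) = .zero := rfl
  have hgr : Grows (E.buffer η ⟨1, 1⟩) (E.state η ⟨1 - 1, Q.f + 2⟩).dag
      (NodeState.initial : NodeState N P).dag := by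
    rw [show (1 : ℕ) - 1 = 0 from rfl, (E.init η hη).1]
    exact .refl _ _
  refine ⟨(NodeState.initial : NodeState N P).dag, p, r, hr, hgr, hdag, hown, hd, ?_, ?_, ?_, ?_,
    fun h => by omega⟩
  · rw [ho, earlyOrder, if_pos rfl]; rfl
  · rw [he]; exact id
  · intro C hC
    simp only [NodeState.initial, Finset.mem_singleton] at hC
    subst hC
    trivial
  · intro C hC
    refine ⟨C, hC, C.self_mem_cone, ?_⟩
    simp only [NodeState.initial, Finset.mem_singleton] at hC
    subst hC
    rfl

theorem validCone_last (hp : ∀ r, 1 ≤ r → r < s → E.SlotOK r) (hs : 2 ≤ s) (hη : E.correct η)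
    (ha : E.awake s η) {μ : N} (hμ : E.correct μ) (hμa : E.awake (s - 1) μ) {B : Block N P}
    (hB : (E.state μ ⟨s - 1, Q.f + 2⟩).own = some B) :
    ValidCone Q (E.buffer η ⟨s, 1⟩) B := by
  refine ⟨E.cone_subset_buffer_first hs hη ha hμ hμa hB, ?_⟩
  rw [← E.dag_eq_cone hμ (isRound_last (by omega)) hμa hB]
  exact ((hp (s - 1) (by omega) (by omega)).late μ hμ hμa).2.2.2

variable [Finite N]

theorem exists_correct_awake (hmaj : E.numAwakeByzantine s < E.numAwakeCorrect s) :
    ∃ η, E.correct η ∧ E.awake s η :=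
  (Set.ncard_pos (Set.toFinite _)).1 (Nat.zero_lt_of_lt hmaj)

theorem enters_of_awake (hbyz : Set.ncard {ν : N | ¬ E.correct ν} ≤ Q.f)
    (hmaj : E.numAwakeByzantine (s - 1) < E.numAwakeCorrect (s - 1))
    (hp : ∀ r, 1 ≤ r → r < s → E.SlotOK r) (hs : 2 ≤ s) (hη : E.correct η)
    (ha : E.awake s η) (haw : E.awake (s - 1) η) : ∃ D p r, E.Enters s η D p r := by
  have hround : Time.IsRound Q.f ⟨s, 1⟩ := isRound_first (by omega)
  have hroundp : Time.IsRound Q.f ⟨s - 1, Q.f + 2⟩ := isRound_last (by omega)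
  have hps := hp (s - 1) (by omega) (by omega)
  obtain ⟨st₁, st₂, p, r, h1, h2, hr, hdag, hd, ho, he, hown⟩ := E.round_spec hη hround ha
  rw [Time.prev_one] at h1
  obtain ⟨hx1, hx2, hx3, hx4⟩ := hps.late η hη haw
  obtain ⟨B₀, hB₀⟩ := E.exists_own hη hroundp haw
  obtain ⟨hB1, hB2, hB3, hB4, -⟩ := E.own_node_time hη hroundp haw hB₀
  obtain ⟨hst, hsub, hnew, hcand⟩ := h1.spec
  have hst₂ : st₂ = { st₁ with elss := False } := by
    simp only [if_true, if_neg (show s ≠ 1 by omega), if_pos haw] at h2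
    rw [h2]
    refine E.switchChain_eq hbyz hmaj hp hη hs ha ?_ ?_ ?_
    · rw [hst]; exact hx1
    · rw [hst]; exact hx3
    · intro B hB
      rw [hst, hB₀] at hB
      obtain rfl := Option.some.inj hB
      rw [hB3, hx1]
  have hd₂ : st₂.digest = E.backbone (s - 1) := by rw [hst₂, hst]; exact hx1
  have hdag₂ : st₂.dag = st₁.dag := by rw [hst₂]
  rw [hd₂] at hdag hd hown
  rw [hdag₂] at hr hdag
  refine ⟨st₁.dag, p, r, hr, h1.grows, hdag, hown, hd, ?_, ?_, ?_, ?_, ?_⟩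
  · rw [ho, hst₂, hst, earlyOrder, if_neg (by omega)]; exact hx2
  · rw [he, hst₂]; exact id
  · intro C hC
    by_cases hCx : C ∈ (E.state η ⟨s - 1, Q.f + 2⟩).dag
    · exact hx4 C hCx
    · obtain ⟨B, -, X, -, hacc, hCB, -⟩ := hnew C hC hCx
      exact hacc.2.2.2 C hCB
  · intro C hC
    by_cases hCx : C ∈ (E.state η ⟨s - 1, Q.f + 2⟩).dag
    · refine ⟨B₀, hsub hB4, ?_, by rw [hB3, hx1]⟩
      rwa [← E.dag_eq_cone hη hroundp haw hB₀]
    · obtain ⟨B, hB, X, -, hacc, hCB, hBs⟩ := hnew C hC hCx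
      refine ⟨B, hBs B.self_mem_cone, hCB, ?_⟩
      rw [(mem_candidates.1 hB).2.2.2.1, hx1]
  · intro _ μ hμ hμa
    obtain ⟨B, hB⟩ := E.exists_own hμ hroundp hμa
    obtain ⟨hB1', hB2', hB3', hB4', -⟩ := E.own_node_time hμ hroundp hμa hB
    have hval := E.validCone_last hp hs hη ha hμ hμa hB
    rw [E.dag_eq_cone hμ hroundp hμa hB]
    refine hcand ?_ B ?_ ?_
    · rw [hB₀, Time.prev_one, Option.map_some, hB2]
    · refine mem_candidates.2 ⟨hval.1 B.self_mem_cone, hval.1, ?_, ?_, ?_⟩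
      · rw [hB2', Time.prev_one]
      · rw [hB3', (hps.late μ hμ hμa).1, hx1]
      · intro ν hν
        rw [hB1'] at hν
        obtain rfl := Option.some.inj hν
        exact E.not_mem_eqSet_buffer hη hround hμ
    · refine ⟨fun C hC hCs => ?_, fun C _ _ _ _ => Nat.zero_le _, hval⟩
      have := slot_lt_of_time_lt (E.not_future η _ C hη hround (hval.1 hC)) (hval.2 C hC)
        (by omega)
      simp only at hCs
      omega

open scoped Classical in
theorem enters_of_asleep (hmaj : E.numAwakeByzantine (s - 1) < E.numAwakeCorrect (s - 1))
    (hp : ∀ r, 1 ≤ r → r < s → E.SlotOK r) (hs : 2 ≤ s) (hη : E.correct η)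
    (ha : E.awake s η) (haw : ¬ E.awake (s - 1) η) : ∃ D p r, E.Enters s η D p r := by
  have hround : Time.IsRound Q.f ⟨s, 1⟩ := isRound_first (by omega)
  have hroundp : Time.IsRound Q.f ⟨s - 1, Q.f + 2⟩ := isRound_last (by omega)
  have hps := hp (s - 1) (by omega) (by omega)
  obtain ⟨st₁, st₂, p, r, h1, h2, hr, hdag, hd, ho, he, hown⟩ := E.round_spec hη hround ha
  rw [Time.prev_one] at h1
  have hbefore := E.state_before_slot hη (s - 1)
  have hst₁ : st₁ = E.state η ⟨s - 1, Q.f + 2⟩ := by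
    refine eq_of_updateDAG_of_own_ne h1 ?_
    rw [Time.prev_one]
    rcases hbefore with h | ⟨q, hq1, hq2, hqa, h⟩
    · rw [h]; simp [NodeState.initial]
    · obtain ⟨B, hB⟩ := E.exists_own hη (isRound_last hq1) hqa
      have htime := (E.own_node_time hη (isRound_last hq1) hqa hB).2.1
      rw [h, hB, Option.map_some, htime]
      intro hEq
      simp only [Option.some.injEq, Time.mk.injEq, and_true] at hEq
      exact haw (hEq ▸ hqa)
  subst hst₁
  simp only [if_true, if_neg (show s ≠ 1 by omega), if_neg haw] at h2
  have hgrows := h2.grows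
  have hmajority := E.numTotal_lt hmaj hs hps hη ha
  rcases h2 with ⟨d, -, hmax, rfl⟩ | ⟨h0, -⟩
  swap
  · rw [h0] at hmajority; omega
  obtain rfl : d = E.backbone (s - 1) :=
    E.eq_backbone_of_votes hmaj hs hps hη ha (hmax _)
  -- the last blocks of the correct nodes of the preceding slot are among the merged ones
  have hmerge : ∀ μ, E.correct μ → E.awake (s - 1) μ → ∀ B,
      (E.state μ ⟨s - 1, Q.f + 2⟩).own = some B → B ∈ (E.buffer η ⟨s, 1⟩) ∧
        B.digest = E.backbone (s - 1) ∧ ValidCone Q (E.buffer η ⟨s, 1⟩) B ∧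
        ∃ ν, ν ∉ eqSet (E.buffer η ⟨s, 1⟩) ∧
          lastBlockFrom Q.f (E.buffer η ⟨s, 1⟩) ν = some B := by
    intro μ hμ hμa B hB
    have hval := E.validCone_last hp hs hη ha hμ hμa hB
    refine ⟨hval.1 B.self_mem_cone, ?_, hval, μ, E.not_mem_eqSet_buffer hη hround hμ,
      E.lastBlockFrom_correct hs hη ha hμ hμa hB⟩
    rw [(E.own_node_time hμ hroundp hμa hB).2.2.1, (hps.late μ hμ hμa).1]
  -- a node that wakes up knows nothing that the awake correct nodes do not know
  have hold : ∀ μ, E.correct μ → E.awake (s - 1) μ →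
      (E.state η ⟨s - 1, Q.f + 2⟩).dag ⊆ (E.state μ ⟨s - 1, Q.f + 2⟩).dag := by
    intro μ hμ hμa
    obtain ⟨hcl, hgen, -, -⟩ := E.dag_invariant hμ _ hroundp
    rcases hbefore with h | ⟨q, hq1, hq2, hqa, h⟩
    · rw [h]
      intro C hC
      simp only [NodeState.initial, Finset.mem_singleton] at hC
      rwa [hC]
    · have hqs : q < s - 1 := by
        rcases hq2.lt_or_eq with h | rfl
        · exact h
        · exact absurd hqa haw
      obtain ⟨B, hB⟩ := E.exists_own hη (isRound_last hq1) hqa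
      rw [h, E.dag_eq_cone hη (isRound_last hq1) hqa hB]
      exact hcl B (hps.prior μ hμ hμa η ⟨q, Q.f + 2⟩ B hη (isRound_last hq1) hqa hqs hB).1
  obtain ⟨μ₀, hμ₀, hμ₀a⟩ := E.exists_correct_awake hmaj
  refine ⟨_, p, r, hr, hgrows, hdag, hown, hd, ?_, ?_, ?_, ?_, ?_⟩
  · rw [ho, earlyOrder, if_neg (by omega)]
  · rw [he]
    rcases hbefore with h | ⟨q, hq1, hq2, hqa, h⟩
    · simp only [h]; exact id
    · simp only [h]; exact ((hp q hq1 (by omega)).late η hη hqa).2.2.1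
  · intro C hC
    rcases Finset.mem_union.1 hC with hC | hC
    · exact (hps.late μ₀ hμ₀ hμ₀a).2.2.2 C (hold μ₀ hμ₀ hμ₀a hC)
    · obtain ⟨B, hB, hCB⟩ := Finset.mem_biUnion.1 hC
      exact (Finset.mem_filter.1 hB).2.2.1.2 C hCB
  · intro C hC
    rcases Finset.mem_union.1 hC with hC | hC
    · obtain ⟨B, hB⟩ := E.exists_own hμ₀ hroundp hμ₀a
      have hB' := hmerge μ₀ hμ₀ hμ₀a B hB
      refine ⟨B, Finset.mem_union_right _ (Finset.mem_biUnion.2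
        ⟨B, Finset.mem_filter.2 hB', B.self_mem_cone⟩), ?_, hB'.2.1⟩
      rw [← E.dag_eq_cone hμ₀ hroundp hμ₀a hB]
      exact hold μ₀ hμ₀ hμ₀a hC
    · obtain ⟨B, hB, hCB⟩ := Finset.mem_biUnion.1 hC
      exact ⟨B, Finset.mem_union_right _ (Finset.mem_biUnion.2 ⟨B, hB, B.self_mem_cone⟩), hCB,
        (Finset.mem_filter.1 hB).2.1⟩
  · intro _ μ hμ hμa C hC
    obtain ⟨B, hB⟩ := E.exists_own hμ hroundp hμa
    rw [E.dag_eq_cone hμ hroundp hμa hB] at hC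
    exact Finset.mem_union_right _ (Finset.mem_biUnion.2
      ⟨B, Finset.mem_filter.2 (hmerge μ hμ hμa B hB), hC⟩)

end Execution

/-! ### The rounds inside a slot -/

namespace Execution

variable {Q : Protocol N P} (E : Execution Q)

variable {s i : ℕ} {η : N}

/-- What all awake correct nodes satisfy in round `i ≤ f + 1` of slot `s`. -/
structure InSlot (s i : ℕ) : Prop where
  digest : ∀ η, E.correct η → E.awake s η → (E.state η ⟨s, i⟩).digest = E.backbone (s - 1)
  order : ∀ η, E.correct η → E.awake s η → (E.state η ⟨s, i⟩).orderOwn = E.earlyOrder s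
  elss : ∀ η, E.correct η → E.awake s η → ¬ (E.state η ⟨s, i⟩).elss
  ok : ∀ η, E.correct η → E.awake s η → ∀ C ∈ (E.state η ⟨s, i⟩).dag, BlockOK Q C
  noEq : ∀ η, E.correct η → E.awake s η → ∀ C ∈ (E.state η ⟨s, i⟩).dag, C.slot = s →
    ∀ ν, C.node = some ν → ν ∉ (E.backbone (s - 1)).eqSet
  /-- An uncommitted block of an earlier slot that was added in this round is reachable from blocks
  of at least `i` nodes. -/
  reach : ∀ η, E.correct η → E.awake s η → ∀ C ∈ (E.state η ⟨s, i⟩).dag, C.slot < s →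
    C ∉ (E.backbone (s - 1)).order → (2 ≤ i → C ∉ (E.state η ⟨s, i - 1⟩).dag) →
    ∀ B, (E.state η ⟨s, i⟩).own = some B → i ≤ reachNumber C B
  /-- The DAGs of the preceding round have been exchanged. -/
  incl : 2 ≤ i → ∀ η μ, E.correct η → E.awake s η → E.correct μ → E.awake s μ →
    (E.state μ ⟨s, i - 1⟩).dag ⊆ (E.state η ⟨s, i⟩).dag

/-- What `UpdateDAG()` does to the DAG of an awake correct node `η` in round `i + 1` of slot `s`. -/
structure Updated (s i : ℕ) (η : N) (D : Finset (Block N P)) : Prop where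
  grows : Grows (E.buffer η ⟨s, i + 1⟩) (E.state η ⟨s, i⟩).dag D
  incl : ∀ μ, E.correct μ → E.awake s μ → (E.state μ ⟨s, i⟩).dag ⊆ D
  ok : ∀ C ∈ D, BlockOK Q C
  noEq : ∀ C ∈ D, C.slot = s → ∀ ν, C.node = some ν → ν ∉ (E.backbone (s - 1)).eqSet
  top : TopDigest (E.backbone (s - 1)) D
  reach : ∀ C ∈ D, C ∉ (E.state η ⟨s, i⟩).dag → C.slot < s →
    C ∉ (E.backbone (s - 1)).order → ∃ B : Block N P, B.cone ⊆ D ∧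
      B.cone ⊆ E.buffer η ⟨s, i + 1⟩ ∧ B.slot = s ∧ C ∈ B.cone ∧ i ≤ reachNumber C B

/-- The block of a correct node passes the test of `UpdateDAG()` at every correct node: a block `C`
in its cone that the receiver lacks cannot have been broadcast one round earlier, so it
was added in the current round and is reachable from sufficiently many nodes. -/
theorem InSlot.updated (h : E.InSlot s i) (hs : 1 ≤ s) (hi : 1 ≤ i) (hif : i ≤ Q.f + 1)
    (hη : E.correct η) (ha : E.awake s η) {st : NodeState N P}
    (hst : UpdateDAG Q ⟨s, i + 1⟩ (E.buffer η ⟨s, i + 1⟩) (E.state η ⟨s, i⟩) st) :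
    E.Updated s i η st.dag := by
  have hround : Time.IsRound Q.f ⟨s, i⟩ := ⟨hs, hi, by simp only; omega⟩
  have hround' : Time.IsRound Q.f ⟨s, i + 1⟩ := ⟨hs, by simp, by simp only; omega⟩
  have hprev := Time.prev_succ Q.f s hi
  obtain ⟨-, hsub, hnew, hcand⟩ := hst.spec
  obtain ⟨B₀, hB₀⟩ := E.exists_own hη hround ha
  obtain ⟨-, hB2, hB3, hB4, -⟩ := E.own_node_time hη hround ha hB₀
  have hd := h.digest η hη ha
  refine ⟨hst.grows, fun μ hμ hμa => ?_, fun C hC => ?_, fun C hC => ?_, fun C hC => ?_,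
    fun C hC hCx hCs hCo => ?_⟩
  · obtain ⟨B, hB⟩ := E.exists_own hμ hround hμa
    obtain ⟨hB1', hB2', hB3', -, -⟩ := E.own_node_time hμ hround hμa hB
    have hcone := E.dag_eq_cone hμ hround hμa hB
    have hbuf : B.cone ⊆ E.buffer η ⟨s, i + 1⟩ := by
      refine E.delivery η μ ⟨s, i + 1⟩ B hη hμ hround' ha ?_ ?_ ?_ <;> rw [hprev]
      exacts [hround, hμa, hB]
    rw [hcone]
    refine hcand ?_ B ?_ ⟨?_, fun C hC hCD hCs hCo => ?_, hbuf, ?_⟩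
    · rw [hB₀, Option.map_some, hB2, hprev]
    · refine mem_candidates.2 ⟨hbuf B.self_mem_cone, hbuf, by rw [hB2', hprev], ?_, ?_⟩
      · rw [hB3', h.digest μ hμ hμa, hd]
      · intro ν hν
        rw [hB1'] at hν
        obtain rfl := Option.some.inj hν
        exact E.not_mem_eqSet_buffer hη hround' hμ
    · rw [← hcone, hd]
      exact h.noEq μ hμ hμa
    · rw [hd] at hCo
      rw [← hcone] at hC
      exact h.reach μ hμ hμa C hC hCs hCo
        (fun h2 hC' => hCD (h.incl h2 η μ hη ha hμ hμa hC')) B hB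
    · rw [← hcone]
      exact h.ok μ hμ hμa
  · by_cases hCx : C ∈ (E.state η ⟨s, i⟩).dag
    · exact h.ok η hη ha C hCx
    · obtain ⟨B, -, X, -, hacc, hCB, -⟩ := hnew C hC hCx
      exact hacc.2.2.2 C hCB
  · by_cases hCx : C ∈ (E.state η ⟨s, i⟩).dag
    · exact h.noEq η hη ha C hCx
    · obtain ⟨B, -, X, -, hacc, hCB, -⟩ := hnew C hC hCx
      rw [← hd]
      exact hacc.1 C hCB
  · by_cases hCx : C ∈ (E.state η ⟨s, i⟩).dag
    · refine ⟨B₀, hsub hB4, ?_, by rw [hB3, hd]⟩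
      rwa [← E.dag_eq_cone hη hround ha hB₀]
    · obtain ⟨B, hB, X, -, hacc, hCB, hBs⟩ := hnew C hC hCx
      refine ⟨B, hBs B.self_mem_cone, hCB, ?_⟩
      rw [(mem_candidates.1 hB).2.2.2.1, hd]
  · obtain ⟨B, hB, X, hCX, hacc, hCB, hBs⟩ := hnew C hC hCx
    obtain ⟨-, hB1, hB2, -, -⟩ := mem_candidates.1 hB
    refine ⟨B, hBs, hB1, ?_, hCB, ?_⟩
    · rw [B.slot_eq_time_slot Q.f, hB2, hprev]
    · rw [hd] at hacc
      exact hacc.2.1 C hCB hCX hCs hCo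

section finite

variable [Finite N]

/-- One more node supports `C` if the cone of `B'` is extended by the block `B`, which reaches `C`, of
a node that did not support `C` before. -/
theorem lt_reachNumber {C B B' : Block N P} {ν : N} (hν : B.node = some ν) (hCB : C ∈ B.cone)
    (hsub : B'.cone ⊆ B.cone) (hslot : B'.slot = B.slot)
    (hnew : ∀ X ∈ B'.cone, X.slot = B.slot → X.node = some ν → C ∉ X.cone) :
    reachNumber C B' < reachNumber C B := by
  refine Set.ncard_lt_ncard ⟨?_, fun hle => ?_⟩ (Set.toFinite _)
  · rintro μ ⟨X, hX, hXs, h⟩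
    exact ⟨X, hsub hX, hXs.trans hslot, h⟩
  · obtain ⟨X, hX, hXs, hXν, hCX⟩ := hle
      (show ν ∈ {ν : N | ∃ E ∈ B.cone, E.slot = B.slot ∧ E.node = some ν ∧ C ∈ E.cone} from
        ⟨B, B.self_mem_cone, rfl, hν, hCB⟩)
    exact hnew X hX (hXs.trans hslot) hXν hCX

theorem inSlot_one (hp : ∀ r, 1 ≤ r → r < s → E.SlotOK r) (hs : 1 ≤ s)
    (h : ∀ η, E.correct η → E.awake s η → ∃ D p r, E.Enters s η D p r) : E.InSlot s 1 := by
  have hround : Time.IsRound Q.f ⟨s, 1⟩ := isRound_first hs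
  have hp' : ∀ r, 1 ≤ r → r ≤ s - 1 → E.SlotOK r := fun r h1 h2 => hp r h1 (by omega)
  have htime : ∀ η, E.correct η → ∀ D p r, E.Enters s η D p r →
      Closed D ∧ D.Nonempty ∧ ∀ C ∈ D, C.time Q.f < ⟨s, 1⟩ := by
    intro η hη D p r hD
    have hgr := hD.grows
    rw [← Time.prev_one] at hgr
    obtain ⟨h1, h2, -⟩ := E.dag_closed_prev hη hround
    exact ⟨hgr.closed h1, ⟨_, hgr.1 h2⟩, E.time_lt_of_grows hη hround hgr⟩
  refine ⟨fun η hη ha => ?_, fun η hη ha => ?_, fun η hη ha => ?_, fun η hη ha C hC => ?_,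
    fun η hη ha C hC hCs ν hν => ?_, fun η hη ha C hC hCs hCo _ B hB => ?_,
    fun h => by omega⟩
  all_goals obtain ⟨D, p, r, hD⟩ := h η hη ha
  · exact hD.digest
  · exact hD.order
  · exact hD.elss
  · obtain ⟨hcl, hne, ht⟩ := htime η hη D p r hD
    rw [hD.dag] at hC
    rcases Finset.mem_insert.1 hC with rfl | hC
    · refine blockOK_mk_of_round_lt hcl hne hD.tips hround ht hD.top (by simp) ?_
      rw [E.slot_backbone hp']
      push_cast [hs]
      ring
    · exact hD.ok C hC
  · obtain ⟨hcl, hne, ht⟩ := htime η hη D p r hD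
    rw [hD.dag] at hC
    rcases Finset.mem_insert.1 hC with rfl | hC
    · obtain rfl := Option.some.inj hν
      exact E.not_mem_eqSet_backbone hp' hη
    · exact absurd hCs (slot_lt_of_time_lt (ht C hC) (hD.ok C hC) hs).ne
  · rw [E.dag_eq_cone hη hround ha hB] at hC
    exact (Set.ncard_pos (Set.toFinite _)).2
      ⟨η, B, B.self_mem_cone, rfl, (E.own_node_time hη hround ha hB).1, hC⟩

theorem InSlot.succ (h : E.InSlot s i) (hp : ∀ r, 1 ≤ r → r < s → E.SlotOK r) (hs : 1 ≤ s)
    (hi : 1 ≤ i) (hif : i + 1 ≤ Q.f + 1) : E.InSlot s (i + 1) := by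
  have hround : Time.IsRound Q.f ⟨s, i⟩ := ⟨hs, hi, by simp only; omega⟩
  have hround' : Time.IsRound Q.f ⟨s, i + 1⟩ := ⟨hs, by simp, by simp only; omega⟩
  have hp' : ∀ r, 1 ≤ r → r ≤ s - 1 → E.SlotOK r := fun r h1 h2 => hp r h1 (by omega)
  have hprev := Time.prev_succ Q.f s hi
  have key : ∀ η, E.correct η → E.awake s η → ∃ (D : Finset (Block N P)) (p : P)
      (r : List (Block N P)), E.Updated s i η D ∧ (r : Multiset (Block N P)) = (tips D).val ∧
      (E.state η ⟨s, i + 1⟩).dag =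
        insert (Block.mk η ⟨s, i + 1⟩ (E.backbone (s - 1)) p r) D ∧
      (E.state η ⟨s, i + 1⟩).digest = E.backbone (s - 1) ∧
      (E.state η ⟨s, i + 1⟩).orderOwn = E.earlyOrder s ∧
      ¬ (E.state η ⟨s, i + 1⟩).elss ∧
      (E.state η ⟨s, i + 1⟩).own =
        some (Block.mk η ⟨s, i + 1⟩ (E.backbone (s - 1)) p r) := by
    intro η hη ha
    obtain ⟨st₁, st₂, p, r, h1, h2, hr, hdag, hd, ho, he, hown⟩ := E.round_spec hη hround' ha
    rw [hprev] at h1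
    simp only [if_neg (show i + 1 ≠ 1 by omega),
      if_neg (show i + 1 ≠ Q.f + 2 by omega)] at h2
    subst h2
    have hst := h1.spec.1
    have hdig : st₂.digest = E.backbone (s - 1) := by rw [hst]; exact h.digest η hη ha
    rw [hdig] at hdag hd hown
    refine ⟨st₂.dag, p, r, h.updated E hs hi (by omega) hη ha h1, hr, hdag, hd, ?_, ?_, hown⟩
    · rw [ho, hst]; exact h.order η hη ha
    · rw [he, hst]; exact h.elss η hη ha
  refine ⟨fun η hη ha => ?_, fun η hη ha => ?_, fun η hη ha => ?_, fun η hη ha C hC => ?_,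
    fun η hη ha C hC hCs ν hν => ?_, fun η hη ha C hC hCs hCo hCi B hB => ?_,
    fun _ η μ hη ha hμ hμa => ?_⟩
  all_goals obtain ⟨D, p, r, hD, hr, hdag, hd, ho, he, hown⟩ := key η hη ha
  all_goals
    have hgr := hD.grows
    rw [← hprev] at hgr
  · exact hd
  · exact ho
  · exact he
  · rw [hdag] at hC
    rcases Finset.mem_insert.1 hC with rfl | hC
    · obtain ⟨h1, h2, -⟩ := E.dag_closed_prev hη hround'
      refine blockOK_mk_of_round_lt (hgr.closed h1) ⟨_, hgr.1 h2⟩ hr hround'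
        (E.time_lt_of_grows hη hround' hgr) hD.top (by simp only; omega) ?_
      rw [E.slot_backbone hp']
      push_cast [hs]
      ring
    · exact hD.ok C hC
  · rw [hdag] at hC
    rcases Finset.mem_insert.1 hC with rfl | hC
    · obtain rfl := Option.some.inj hν
      exact E.not_mem_eqSet_backbone hp' hη
    · exact hD.noEq C hC hCs ν hν
  · have hcone := E.dag_eq_cone hη hround' ha hB
    obtain ⟨hBη, hBt, -, -, -⟩ := E.own_node_time hη hround' ha hB
    have hBs : B.slot = s := by rw [B.slot_eq_time_slot Q.f, hBt]
    have hCi' := hCi (by omega)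
    rw [Nat.add_sub_cancel] at hCi'
    have hCB := hC
    rw [hcone] at hCB
    rw [hdag] at hC
    rcases Finset.mem_insert.1 hC with rfl | hC
    · exact absurd hCs (lt_irrefl _)
    · obtain ⟨B', hB'D, hB'b, hB's, hCB', hle⟩ := hD.reach C hC hCi' hCs hCo
      refine Nat.succ_le_of_lt (hle.trans_lt (lt_reachNumber hBη hCB ?_ (hB's.trans hBs.symm) ?_))
      · rw [← hcone, hdag]
        exact hB'D.trans (Finset.subset_insert _ _)
      · -- an earlier block of `η` in this slot reaches only blocks that were in its DAG before
        intro X hX hXs hXη hCX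
        obtain ⟨t, htlt, ht, hta, hto⟩ :=
          E.unforgeable η ⟨s, i + 1⟩ X η hη hround' (hB'b hX) hXη hη
        obtain ⟨-, hXt, -, hXdag, -⟩ := E.own_node_time hη ht hta hto
        have hle' : t < ⟨s, i⟩ ∨ t = ⟨s, i⟩ := by
          rw [← hprev]; exact Time.lt_prev_or_eq ht hround' htlt
        exact hCi' ((E.dag_invariant hη _ hround).1 X (E.dag_mono hη ht hround hle' hXdag) hCX)
  · rw [hdag, Nat.add_sub_cancel]
    exact (hD.incl μ hμ hμa).trans (Finset.subset_insert _ _)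

/-- In the last round, a block that was added only now is reachable from blocks of `f + 1` nodes.
One of these nodes is correct, so every correct node has received the block. -/
theorem Updated.agreement (hbyz : Set.ncard {ν : N | ¬ E.correct ν} ≤ Q.f) (hs : 1 ≤ s)
    {μ : N} (hη : E.correct η) (ha : E.awake s η) {D D' : Finset (Block N P)}
    (hD : E.Updated s (Q.f + 1) η D) (hD' : E.Updated s (Q.f + 1) μ D')
    (hcl : Closed D') {C : Block N P} (hC : C ∈ D) (hCs : C.slot < s)
    (hCo : C ∉ (E.backbone (s - 1)).order) : C ∈ D' := by
  have hround : Time.IsRound Q.f ⟨s, Q.f + 1⟩ := ⟨hs, by simp, by simp⟩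
  have hround' : Time.IsRound Q.f ⟨s, Q.f + 1 + 1⟩ := ⟨hs, by simp, by simp⟩
  by_cases hCx : C ∈ (E.state η ⟨s, Q.f + 1⟩).dag
  · exact hD'.incl η hη ha hCx
  · obtain ⟨B, -, hBb, hBs, -, hle⟩ := hD.reach C hC hCx hCs hCo
    obtain ⟨ν, ⟨X, hX, hXs, hXν, hCX⟩, hν⟩ := E.exists_correct_of_lt_ncard hbyz hle
    obtain ⟨t, htlt, ht, hta, hto⟩ := E.unforgeable η _ X ν hη hround' (hBb hX) hXν hν
    obtain ⟨-, hXt, -, hXdag, -⟩ := E.own_node_time hν ht hta hto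
    have hts : t.slot = s := by rw [← hXt, ← X.slot_eq_time_slot, hXs, hBs]
    have hle' : t < ⟨s, Q.f + 1⟩ ∨ t = ⟨s, Q.f + 1⟩ := by
      have := Time.lt_prev_or_eq ht hround' htlt
      rwa [Time.prev_succ Q.f s (by omega)] at this
    rw [hts] at hta
    exact hcl X (hD'.incl ν hν hta (E.dag_mono hν ht hround hle' hXdag)) hCX

/-! ### The induction on slots -/

theorem slotOK_of_forall_lt (hbyz : Set.ncard {ν : N | ¬ E.correct ν} ≤ Q.f)
    (hmaj : ∀ s : ℕ, 1 ≤ s → E.numAwakeByzantine s < E.numAwakeCorrect s) (hs : 1 ≤ s)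
    (hp : ∀ r, 1 ≤ r → r < s → E.SlotOK r) : E.SlotOK s := by
  have hp' : ∀ r, 1 ≤ r → r ≤ s - 1 → E.SlotOK r := fun r h1 h2 => hp r h1 (by omega)
  have henter : ∀ η, E.correct η → E.awake s η → ∃ D p r, E.Enters s η D p r := by
    intro η hη ha
    rcases hs.eq_or_lt with rfl | hs2
    · exact E.enters_one hη ha
    · by_cases haw : E.awake (s - 1) η
      · exact E.enters_of_awake hbyz (hmaj _ (by omega)) hp hs2 hη ha haw
      · exact E.enters_of_asleep (hmaj _ (by omega)) hp hs2 hη ha haw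
  have hin : ∀ i : ℕ, 1 ≤ i → i ≤ Q.f + 1 → E.InSlot s i := by
    intro i hi
    induction i, hi using Nat.le_induction with
    | base => exact fun _ => E.inSlot_one hp hs henter
    | succ i hi ih => exact fun h => (ih (by omega)).succ E hp hs hi h
  have hlast := hin (Q.f + 1) (by omega) le_rfl
  have hround' : Time.IsRound Q.f ⟨s, Q.f + 2⟩ := isRound_last hs
  have hprev : Time.prev Q.f ⟨s, Q.f + 2⟩ = ⟨s, Q.f + 1⟩ := Time.prev_succ Q.f s (by omega)
  have key : ∀ η, E.correct η → E.awake s η → ∃ (D : Finset (Block N P)) (p : P)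
      (r : List (Block N P)) (d : Digest N P),
      d = .hash (E.backbone (s - 1)) (Q.concat (newBlocks D (E.backbone (s - 1)) (s - 1))) ∧
      E.Updated s (Q.f + 1) η D ∧ Closed D ∧ D.Nonempty ∧
      (∀ C ∈ D, C.time Q.f < ⟨s, Q.f + 2⟩) ∧
      (r : Multiset (Block N P)) = (tips D).val ∧
      (E.state η ⟨s, Q.f + 2⟩).dag = insert (Block.mk η ⟨s, Q.f + 2⟩ d p r) D ∧
      (E.state η ⟨s, Q.f + 2⟩).digest = d ∧
      (E.state η ⟨s, Q.f + 2⟩).orderOwn = d.order ∧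
      ¬ (E.state η ⟨s, Q.f + 2⟩).elss := by
    intro η hη ha
    obtain ⟨st₁, st₂, p, r, h1, h2, hr, hdag, hd, ho, he, hown⟩ := E.round_spec hη hround' ha
    have hgr := h1.grows
    rw [hprev] at h1
    simp only [if_neg (show Q.f + 2 ≠ 1 by omega), if_true] at h2
    have hst := h1.spec.1
    have hdig : st₁.digest = E.backbone (s - 1) := by rw [hst]; exact hlast.digest η hη ha
    have hdag₂ : st₂.dag = st₁.dag := by rw [h2]; rfl
    rw [hdag₂] at hr hdag
    obtain ⟨hc1, hc2, -⟩ := E.dag_closed_prev hη hround'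
    refine ⟨st₁.dag, p, r, st₂.digest, ?_, hlast.updated E hs (by omega) le_rfl hη ha h1,
      hgr.closed hc1, ⟨_, hgr.1 hc2⟩, E.time_lt_of_grows hη hround' hgr, hr, hdag, hd, ?_, ?_⟩
    · rw [h2, ← hdig]; rfl
    · rw [ho, h2]; rfl
    · rw [he, h2]
      change ¬ st₁.elss
      rw [hst]
      exact hlast.elss η hη ha
  obtain ⟨η₀, hη₀, ha₀, hη₀d⟩ := E.exists_backbone_eq hs (E.exists_correct_awake (hmaj s hs))
  obtain ⟨D₀, p₀, r₀, d₀, hd₀, hD₀, hcl₀, -, -, -, hdag₀, hdig₀, -, -⟩ := key η₀ hη₀ ha₀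
  obtain rfl : d₀ = E.backbone s := by rw [← hη₀d, hdig₀]
  have hnewBlocks : ∀ η ν : N, ∀ D p r, (∃ d : Digest N P, (E.state η ⟨s, Q.f + 2⟩).dag =
      insert (Block.mk ν ⟨s, Q.f + 2⟩ d p r) D) →
      newBlocks (E.state η ⟨s, Q.f + 2⟩).dag (E.backbone (s - 1)) (s - 1) =
        newBlocks D (E.backbone (s - 1)) (s - 1) := by
    rintro η ν D p r ⟨d, h⟩
    rw [h]
    ext C
    simp only [mem_newBlocks, Finset.mem_insert]
    constructor
    · rintro ⟨rfl | h1, h2, h3⟩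
      · simp only [Block.slot] at h2; omega
      · exact ⟨h1, h2, h3⟩
    · rintro ⟨h1, h2⟩; exact ⟨Or.inr h1, h2⟩
  have hcomputed : E.backbone s = .hash (E.backbone (s - 1))
      (Q.concat (newBlocks (E.state η₀ ⟨s, Q.f + 2⟩).dag (E.backbone (s - 1)) (s - 1))) := by
    rw [hnewBlocks η₀ η₀ D₀ p₀ r₀ ⟨_, hdag₀⟩]
    exact hd₀
  have hprior : ∀ η, E.correct η → E.awake s η → ∀ μ t B, E.correct μ → t.IsRound Q.f →
      E.awake t.slot μ → t.slot < s → (E.state μ t).own = some B →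
      B ∈ (E.state η ⟨s, Q.f + 2⟩).dag := by
    intro η hη ha μ t B hμ ht hta hts hB
    have hs2 : 2 ≤ s := by have := ht.1; omega
    obtain ⟨D, p, r, hD⟩ := henter η hη ha
    have hD1 : D ⊆ (E.state η ⟨s, Q.f + 2⟩).dag := by
      refine Finset.Subset.trans ?_
        (E.dag_mono hη (isRound_first hs) hround' (Or.inl (Or.inr ⟨rfl, by simp⟩)))
      rw [hD.dag]
      exact Finset.subset_insert _ _
    apply hD1
    have hBdag := (E.own_node_time hμ ht hta hB).2.2.2.1
    rcases (show t.slot = s - 1 ∨ t.slot < s - 1 by omega) with h | h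
    · rw [h] at hta
      refine hD.incl hs2 μ hμ hta (E.dag_mono hμ ht (isRound_last (by omega)) ?_ hBdag)
      have h3 := ht.2.2
      obtain ⟨a, b⟩ := t
      simp only [Time.lt_def, Time.mk.injEq] at *
      omega
    · obtain ⟨ν, hν, hνa⟩ := E.exists_correct_awake (hmaj (s - 1) (by omega))
      exact hD.incl hs2 ν hν hνa
        ((hp (s - 1) (by omega) (by omega)).prior ν hν hνa μ t B hμ ht
          hta h hB).1
  refine ⟨fun η hη ha i hi hif => ⟨(hin i hi hif).digest η hη ha, (hin i hi hif).order η hη ha⟩,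
    fun η hη ha => ?_, ⟨η₀, hη₀, ha₀, hcomputed⟩, fun C hC => ?_,
    fun η hη ha μ t B hμ ht hta hts hB => ⟨hprior η hη ha μ t B hμ ht hta hts hB, ?_⟩⟩
  · obtain ⟨D, p, r, d, hd, hD, hcl, hne, htime, hr, hdag, hdig, ho, he⟩ := key η hη ha
    have hdd : d = E.backbone s := by
      rw [hd, hd₀]
      congr 2
      ext C
      simp only [mem_newBlocks]
      constructor
      · rintro ⟨h1, h2, h3⟩
        exact ⟨hD.agreement E hbyz hs hη ha hD₀ hcl₀ h1 (by omega) h3, h2, h3⟩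
      · rintro ⟨h1, h2, h3⟩
        exact ⟨hD₀.agreement E hbyz hs hη₀ ha₀ hD hcl h1 (by omega) h3, h2, h3⟩
    refine ⟨hdig.trans hdd, by rw [ho, hdd], he, fun C hC => ?_⟩
    rw [hdag] at hC
    rcases Finset.mem_insert.1 hC with rfl | hC
    · rw [hd]
      refine blockOK_mk_of_round_eq hcl hne hr hs htime hD.top ?_
      rw [E.slot_backbone hp']
      push_cast [hs]
      ring
    · exact hD.ok C hC
  · rw [hcomputed, Digest.order] at hC
    rcases List.mem_append.1 hC with hC | hC
    · exact E.issued_backbone hp' hC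
    · exact (E.dag_invariant hη₀ _ hround').2.2.2 C
        (mem_newBlocks.1 ((mem_concat Q).1 hC)).1
  · rw [hcomputed, Digest.order]
    by_cases hBo : B ∈ (E.backbone (s - 1)).order
    · exact List.mem_append_left _ hBo
    · refine List.mem_append_right _ ((mem_concat Q).2 (mem_newBlocks.2
        ⟨hprior η₀ hη₀ ha₀ μ t B hμ ht hta hts hB, ?_, hBo⟩))
      rw [B.slot_eq_time_slot Q.f, (E.own_node_time hμ ht hta hB).2.1]
      omega

theorem slotOK (hbyz : Set.ncard {ν : N | ¬ E.correct ν} ≤ Q.f)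
    (hmaj : ∀ s : ℕ, 1 ≤ s → E.numAwakeByzantine s < E.numAwakeCorrect s) (hs : 1 ≤ s) :
    E.SlotOK s := by
  induction s using Nat.strong_induction_on with
  | _ s ih => exact E.slotOK_of_forall_lt hbyz hmaj hs fun r h1 h2 => ih r h2 h1

end finite

/-- The digest for slot `0` commits exactly `Genesis`, so the initial `Order_own` agrees
with it. -/
theorem order_backbone_one (h : E.SlotOK 1) : (E.backbone 1).order = [.genesis] := by
  obtain ⟨η, hη, ha, hb⟩ := h.computed
  have hnew : newBlocks (E.state η ⟨1, Q.f + 2⟩).dag (E.backbone (1 - 1)) (1 - 1) =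
      {.genesis} := by
    ext C
    rw [mem_newBlocks, Finset.mem_singleton]
    constructor
    · rintro ⟨hC, hs, -⟩
      cases C with
      | genesis => rfl
      | mk ν t d p r =>
        have := ((h.late η hη ha).2.2.2 _ hC).2.1.1
        simp only [Block.slot] at hs
        omega
    · rintro rfl
      exact ⟨(E.dag_invariant hη _ (isRound_last le_rfl)).2.1, le_rfl, by
        simp [backbone, Digest.order]⟩
  rw [hb, hnew, Digest.order]
  have hconcat : Q.concat {Block.genesis} = [.genesis] := by
    have := Q.concat_spec {Block.genesis}
    rwa [Finset.singleton_val, Multiset.coe_eq_singleton] at this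
  rw [hconcat]
  simp [backbone, Digest.order]

/-- Every `Order_own` is the sequence committed by an agreed digest. -/
theorem exists_orderOwn_eq (hok : ∀ s, 1 ≤ s → E.SlotOK s) (hη : E.correct η) {t : Time}
    (ht : t.IsRound Q.f) : ∃ n, 1 ≤ n ∧ (E.state η t).orderOwn = (E.backbone n).order := by
  have hone := E.order_backbone_one (hok 1 le_rfl)
  obtain ⟨s, i⟩ := t
  obtain ⟨hs, hi, hif⟩ := ht
  simp only at hs hi hif
  by_cases ha : E.awake s η
  · rcases (show i ≤ Q.f + 1 ∨ i = Q.f + 2 by omega) with h | rfl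
    · rw [((hok s hs).early η hη ha i hi h).2, earlyOrder]
      split_ifs with h1
      · exact ⟨1, le_rfl, hone.symm⟩
      · exact ⟨s - 1, by omega, rfl⟩
    · exact ⟨s, hs, ((hok s hs).late η hη ha).2.1⟩
  · rw [E.state_asleep hη hs ha hi hif]
    rcases E.state_before_slot hη (s - 1) with h | ⟨r, hr1, -, hra, h⟩
    · exact ⟨1, le_rfl, by rw [h, hone]; rfl⟩
    · exact ⟨r, hr1, by rw [h]; exact ((hok r hr1).late η hη hra).2.1⟩

end Execution

end Slipstream

/-! ### Safety and liveness -/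

theorem mainTheorem1 {N : Type*} {P : Type*} [Finite N] (Q : Slipstream.Protocol N P)
    (E : Slipstream.Execution Q)
    (hbyz : Set.ncard {ν : N | ¬ E.correct ν} ≤ Q.f)
    (hmaj : ∀ s : ℕ, 1 ≤ s → E.numAwakeByzantine s < E.numAwakeCorrect s) :
    (∃ σ : ℤ → Slipstream.Digest N P,
      (∀ k : ℤ, -1 ≤ k → (σ k).slot = k) ∧
      (∀ k : ℤ, 0 ≤ k → (σ k).before = some (σ (k - 1))) ∧
      (∀ η : N, ∀ s i : ℕ, E.correct η → 1 ≤ s → E.awake s η → 1 ≤ i →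
        (i ≤ Q.f + 1 → (E.state η ⟨s, i⟩).digest = σ (s - 2)) ∧
        (i = Q.f + 2 → (E.state η ⟨s, i⟩).digest = σ (s - 1))) ∧
      (∀ η : N, ∀ s i : ℕ, ∀ B : Slipstream.Block N P,
        E.correct η → 1 ≤ s → E.awake s η → 1 ≤ i → i ≤ Q.f + 2 →
        (E.state η ⟨s, i⟩).own = some B →
        B ∈ (σ s).order ∧
        ∀ μ : N, E.correct μ →
          (E.awake (s + 1) μ → B ∈ (E.state μ ⟨s + 1, Q.f + 2⟩).orderOwn) ∧
          ∀ t j : ℕ, s + 2 ≤ t → E.awake t μ → 1 ≤ j → j ≤ Q.f + 2 →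
            B ∈ (E.state μ ⟨t, j⟩).orderOwn)) ∧
    (∀ η μ : N, ∀ a b : Slipstream.Time, E.correct η → E.correct μ →
      a.IsRound Q.f → b.IsRound Q.f →
      (E.state η a).orderOwn <+: (E.state μ b).orderOwn ∨
      (E.state μ b).orderOwn <+: (E.state η a).orderOwn) := by
  have hok : ∀ s, 1 ≤ s → E.SlotOK s := fun s hs => E.slotOK hbyz hmaj hs
  refine ⟨⟨fun k => E.backbone (k + 1).toNat, fun k hk => ?_, fun k hk => ?_,
    fun η s i hη hs ha hi => ⟨fun hif => ?_, ?_⟩, fun η s i B hη hs ha hi hif hB => ?_⟩,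
    fun η μ a b hη hμ ha hb => ?_⟩
  · rw [E.slot_backbone fun r h _ => hok r h]
    omega
  · obtain ⟨l, hl⟩ := (hok (k + 1).toNat (by omega)).extend
    dsimp only
    rw [hl, Slipstream.Digest.before]
    congr 2
    omega
  · rw [((hok s hs).early η hη ha i hi hif).1]
    dsimp only
    congr 1
    omega
  · rintro rfl
    rw [((hok s hs).late η hη ha).1]
    dsimp only
    congr 1
    omega
  · obtain ⟨ν, hν, hνa⟩ := E.exists_correct_awake (hmaj (s + 1) (by omega))
    have hmem : B ∈ (E.backbone (s + 1)).order :=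
      ((hok (s + 1) (by omega)).prior ν hν hνa η ⟨s, i⟩ B hη ⟨hs, hi, hif⟩ ha
        (Nat.lt_succ_self s) hB).2
    have hmono : ∀ n, s + 1 ≤ n → B ∈ (E.backbone n).order := fun n hn =>
      (E.order_backbone_prefix hn fun r h _ => hok r h).subset hmem
    refine ⟨hmem, fun μ hμ => ⟨fun hμa => ?_, fun t j ht hμa hj hjf => ?_⟩⟩
    · rw [((hok (s + 1) (by omega)).late μ hμ hμa).2.1]
      exact hmem
    · have htok := hok t (by omega)
      rcases (show j ≤ Q.f + 1 ∨ j = Q.f + 2 by omega) with h | rfl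
      · rw [(htok.early μ hμ hμa j hj h).2, Slipstream.Execution.earlyOrder, if_neg (by omega)]
        exact hmono _ (by omega)
      · rw [(htok.late μ hμ hμa).2.1]
        exact hmono _ (by omega)
  · obtain ⟨m, hm, hηa⟩ := E.exists_orderOwn_eq hok hη ha
    obtain ⟨n, hn, hμb⟩ := E.exists_orderOwn_eq hok hμ hb
    rw [hηa, hμb]
    exact (le_total m n).imp (fun h => E.order_backbone_prefix h fun r h _ => hok r h)
      (fun h => E.order_backbone_prefix h fun r h _ => hok r h)
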